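/- All graphs are finite, simple and undirected. Let $S_{s}$ denote the star of order $s+1$ (one center joined to $s$ leaves), $P_m$ the path of order $m$, $kH$ the vertex-disjoint union of $k$ copies of $H$, and $G\cup H$ the vertex-disjoint union of $G$ and $H$. For $n\ge h$ let $S_{n,h}=K_h\vee\overline{K}_{n-h}$ be the graph of order $n$ obtained by joining every vertex of a clique of order $h$ to every vertex of an independent set of order $n-h$. A graph is $F$-free if it contains no (not necessarily induced) subgraph isomorphic to $F$. The spectral radius $\rho(G)$ is the largest eigenvalue of the adjacency matrix of $G$, and $\mathrm{Ex}_{sp}(n,F)$ is the set of $F$-free graphs of order $n$ whose spectral radius is maximum among all $F$-free graphs of order $n$ (graphs being considered up to isomorphism). Lemma. Suppose $k_1\ge 1$, $k_2\ge 2$, $\ell\ge 2$ and $$n\ge\max\left\{2^{4(k_1+\ell k_2-1)},\ \left[(4\ell^2-2\ell+1)k_1+(2\ell^2+3\ell-4)k_2+3\right]^2\right\}.$$ Then $$\mathrm{Ex}_{sp}(n,\,k_1S_{2\ell-1}\cup k_2P_{2\ell})=\{S_{n,\,k_1+\ell k_2-1}\}.$$ -/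

import Mathlib

namespace StarPathForest

/-- The star `S_s` of order `s + 1`: one center joined to `s` leaves. -/
def starS (s : ℕ) : SimpleGraph (Fin (s + 1)) :=
  SimpleGraph.starGraph 0

/-- `k H`: the vertex-disjoint union of `k` copies of the graph `H`. -/
def copies {W : Type*} (k : ℕ) (H : SimpleGraph W) : SimpleGraph (Fin k × W) where
  Adj x y := x.1 = y.1 ∧ H.Adj x.2 y.2
  symm := ⟨fun _ _ h => ⟨h.1.symm, h.2.symm⟩⟩
  loopless := ⟨fun _ h => H.irrefl h.2⟩

/-- The forest `k₁ S_{2ℓ-1} ∪ k₂ P_{2ℓ}`: the vertex-disjoint union of `k₁` stars of order `2ℓ`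
and `k₂` paths of order `2ℓ` (used for `ℓ ≥ 1` only, where `2 * ℓ - 1` is not truncated). -/
def starPathForest (k₁ k₂ ℓ : ℕ) :
    SimpleGraph ((Fin k₁ × Fin (2 * ℓ - 1 + 1)) ⊕ (Fin k₂ × Fin (2 * ℓ))) :=
  (copies k₁ (starS (2 * ℓ - 1))).sum (copies k₂ (SimpleGraph.pathGraph (2 * ℓ)))

/-- The join `G ∨ H`: the disjoint union of `G` and `H` together with all edges between them. -/
def join {V W : Type*} (G : SimpleGraph V) (H : SimpleGraph W) : SimpleGraph (V ⊕ W) :=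
  G.sum H ⊔ completeBipartiteGraph V W

/-- `S_{n,h} = K_h ∨ (complement of K_{n-h})`, a graph of order `n` when `h ≤ n`. -/
def completeSplit (n h : ℕ) : SimpleGraph (Fin h ⊕ Fin (n - h)) :=
  join (⊤ : SimpleGraph (Fin h)) (⊥ : SimpleGraph (Fin (n - h)))

open scoped Classical in
/-- The spectral radius `ρ(G)`: the largest eigenvalue of the adjacency matrix of `G`. The spectrum
is finite, and nonempty when `V` is nonempty, so the supremum is then a maximum. -/
noncomputable def adjSpectralRadius {V : Type*} [Fintype V] (G : SimpleGraph V) : ℝ :=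
  sSup (spectrum ℝ (G.adjMatrix ℝ))

/-- `Ex_sp(n, F)`, for the graphs on a given set `V` of `n` vertices: the `F`-free graphs on `V` whose
spectral radius is maximum among all `F`-free graphs on `V`. -/
def spectralExtremal (V : Type*) [Fintype V] {W : Type*} (F : SimpleGraph W) :
    Set (SimpleGraph V) :=
  {G | F.Free G ∧ ∀ G' : SimpleGraph V, F.Free G' → adjSpectralRadius G' ≤ adjSpectralRadius G}

end StarPathForest

/-!
Write `h = k₁ + ℓ k₂ - 1`. The forest `F = k₁ S_{2ℓ-1} ∪ k₂ P_{2ℓ}` has `h + 1` disjoint edges, so a graph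
with a vertex cover of size `h` is `F`-free (`IsCover.starPathForest_free`). Among graphs with such a
cover, summing the eigenvalue equations over the cover and over its complement gives
`ρ (ρ - (h - 1)) ≤ h (n - h)`, with equality only for `S_{n,h}` (`IsCover.adjSpectralRadius_bound`).
It remains to see that an `F`-free graph with `ρ ≥ ρ(S_{n,h})` has a vertex cover of size `h`.

The proof of this is an induction on the number `m ≤ n` of vertices, for graphs satisfying
`ρ (ρ - (h - 1)) ≥ (h - 1) m + √(n m) - h²` (`eq_and_exists_isCover`); for `m = n` the right-hand side is
`h (n - h)`, and for `m < n` it exceeds `h (m - h)`.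
* If some degree is less than `h`, then the smallest entry of the Perron vector is so small that
  deleting its vertex keeps the inequality (`exists_vertex_deletion`, `deletion_inequality`); by
  induction `m - 1 = n`, which is absurd.
* Otherwise all degrees are at least `h`. The inequality forces at least `h` vertices of degree at
  least `|F| - 1`, because `ρ ≤ √(t m) + D` when only `t` vertices have degree more than `D`
  (`adjSpectralRadius_le_sqrt_add`). Any `k₁` of them can be used as star centres, chosen after the
  paths, so the graph without them has no `k₂` disjoint paths `P_{2ℓ}`
  (`starPathForest_isContained`), while its degrees are at least `r = ℓ k₂ - 1`, and at least two
  of them exceed `2r`, those of the remaining vertices of large degree. If it is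
  disconnected, then `k₂ - 1` paths are found in the component of a vertex of large degree and one
  more elsewhere. If it is connected, it has no path on `2r + 2 = 2ℓ k₂` vertices, and
  then it has a vertex cover of size `r` (`exists_isCover_of_connected`); with the `k₁` centres this
  is a vertex cover of size `h`.

For the last step, a longest path `v 0, …, v (2r)` has complementary sets of chords at its two ends. If
a vertex off the path has all its neighbours on the path, these are the vertices of odd index, which
then form a cover. Otherwise the longest tails hanging off the path show that all vertices off the
path lie in sets of `r` vertices attached only to the middle vertex `v r`
(`IsLongestPath.exists_block`), so that `v r` would be the only vertex of degree more than `2r`.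
-/

namespace StarPathForest

/-! ### The spectral radius as a Rayleigh quotient -/

section Spectral

open scoped Classical

variable {V : Type*} [Fintype V]

/-- The value at `u` of the adjacency operator applied to `x`: the sum of `x` over the neighbours
of `u`. -/
noncomputable def nbrSum (G : SimpleGraph V) (x : V → ℝ) (u : V) : ℝ :=
  ∑ v with G.Adj u v, x v

/-- The quadratic form of the adjacency matrix. -/
noncomputable def quad (G : SimpleGraph V) (x : V → ℝ) : ℝ :=
  ∑ u, x u * nbrSum G x u

lemma adjMatrix_mulVec_eq_nbrSum (G : SimpleGraph V) (x : V → ℝ) :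
    (G.adjMatrix ℝ).mulVec x = nbrSum G x := by
  ext u
  simp [Matrix.mulVec, dotProduct, nbrSum, SimpleGraph.adjMatrix_apply, Finset.sum_filter]

lemma nbrSum_add (G : SimpleGraph V) (x y : V → ℝ) (u : V) :
    nbrSum G (x + y) u = nbrSum G x u + nbrSum G y u := by
  simp [nbrSum, Finset.sum_add_distrib]

lemma nbrSum_smul (G : SimpleGraph V) (t : ℝ) (x : V → ℝ) (u : V) :
    nbrSum G (t • x) u = t * nbrSum G x u := by
  simp [nbrSum, Finset.mul_sum]

lemma sum_mul_nbrSum_comm (G : SimpleGraph V) (x y : V → ℝ) :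
    ∑ u, x u * nbrSum G y u = ∑ u, y u * nbrSum G x u := by
  simp only [nbrSum, Finset.sum_filter, Finset.mul_sum]
  rw [Finset.sum_comm]
  refine Finset.sum_congr rfl fun u _ => Finset.sum_congr rfl fun v _ => ?_
  by_cases h : G.Adj u v <;> simp [h, G.adj_comm v u, mul_comm]

lemma quad_add_smul (G : SimpleGraph V) (x z : V → ℝ) (t : ℝ) :
    quad G (x + t • z) = quad G x + 2 * t * ∑ u, z u * nbrSum G x u + t ^ 2 * quad G z := by
  have h := sum_mul_nbrSum_comm G x z
  have e : quad G (x + t • z) = quad G x + t * ∑ u, z u * nbrSum G x u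
      + t * ∑ u, x u * nbrSum G z u + t ^ 2 * quad G z := by
    simp only [quad, Finset.mul_sum, ← Finset.sum_add_distrib]
    refine Finset.sum_congr rfl fun u _ => ?_
    rw [nbrSum_add, nbrSum_smul]
    simp only [Pi.add_apply, Pi.smul_apply, smul_eq_mul]
    ring
  rw [e, h]; ring

lemma quad_smul (G : SimpleGraph V) (t : ℝ) (x : V → ℝ) :
    quad G (t • x) = t ^ 2 * quad G x := by
  simp only [quad, nbrSum_smul, Finset.mul_sum, Pi.smul_apply, smul_eq_mul]
  exact Finset.sum_congr rfl fun u _ => by ring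

lemma quad_le_quad_abs (G : SimpleGraph V) (x : V → ℝ) :
    quad G x ≤ quad G fun v => |x v| := by
  refine Finset.sum_le_sum fun u _ => ?_
  simp only [nbrSum, Finset.mul_sum]
  exact Finset.sum_le_sum fun v _ => by rw [← abs_mul]; exact le_abs_self _

lemma continuous_quad (G : SimpleGraph V) : Continuous (quad G) := by
  unfold quad nbrSum
  fun_prop

lemma mem_spectrum_adjMatrix_iff (G : SimpleGraph V) (μ : ℝ) :
    μ ∈ spectrum ℝ (G.adjMatrix ℝ) ↔ ∃ x : V → ℝ, x ≠ 0 ∧ ∀ u, nbrSum G x u = μ * x u := by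
  rw [← Matrix.spectrum_toLin', ← Module.End.hasEigenvalue_iff_mem_spectrum]
  constructor
  · intro h
    obtain ⟨x, hx⟩ := h.exists_hasEigenvector
    refine ⟨x, hx.2, fun u => ?_⟩
    have := congrFun hx.apply_eq_smul u
    rwa [Matrix.toLin'_apply, adjMatrix_mulVec_eq_nbrSum] at this
  · rintro ⟨x, hx, h⟩
    refine Module.End.hasEigenvalue_of_hasEigenvector (x := x) ⟨?_, hx⟩
    rw [Module.End.mem_eigenspace_iff, Matrix.toLin'_apply, adjMatrix_mulVec_eq_nbrSum]
    ext u
    simp [h u]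

/-- The maximum of the quadratic form on the unit sphere is attained at a nonnegative vector. -/
lemma exists_nonneg_isMax_quad [Nonempty V] (G : SimpleGraph V) :
    ∃ x : V → ℝ, (∀ v, 0 ≤ x v) ∧ ∑ v, x v ^ 2 = 1 ∧
      ∀ y : V → ℝ, quad G y ≤ quad G x * ∑ v, y v ^ 2 := by
  have hK : IsCompact {x : V → ℝ | ∑ v, x v ^ 2 = 1} := by
    refine (isCompact_univ_pi fun _ : V => isCompact_Icc (a := (-1 : ℝ)) (b := 1)).of_isClosed_subset
      (isClosed_eq (by fun_prop) continuous_const) ?_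
    intro x hx v _
    have h1 : x v ^ 2 ≤ 1 := by
      rw [← (show ∑ v, x v ^ 2 = 1 from hx)]
      exact Finset.single_le_sum (f := fun v => x v ^ 2) (fun i _ => sq_nonneg _)
        (Finset.mem_univ v)
    exact abs_le.mp ((sq_le_one_iff_abs_le_one _).mp h1)
  have hne : {x : V → ℝ | ∑ v, x v ^ 2 = 1}.Nonempty := by
    obtain ⟨a⟩ := ‹Nonempty V›
    refine ⟨Pi.single a 1, ?_⟩
    simp [Pi.single_apply]
  obtain ⟨x, hx, hmax⟩ := hK.exists_isMaxOn hne (continuous_quad G).continuousOn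
  have hx1 : ∑ v, x v ^ 2 = 1 := hx
  refine ⟨fun v => |x v|, fun v => abs_nonneg _, by simpa using hx1, fun y => ?_⟩
  have h1 : ∀ y : V → ℝ, ∑ v, y v ^ 2 = 1 → quad G y ≤ quad G fun v => |x v| :=
    fun y hy => (hmax hy).trans (quad_le_quad_abs G x)
  rcases (Finset.sum_nonneg fun v _ => sq_nonneg (y v)).eq_or_lt' with h0 | hpos
  · have hy : y = 0 := by
      ext v
      have := (Finset.sum_eq_zero_iff_of_nonneg fun v _ => sq_nonneg (y v)).mp h0 v
        (Finset.mem_univ v)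
      simpa using this
    rw [h0, hy]
    simp [quad]
  · set s := ∑ v, y v ^ 2 with hs
    have h2 := h1 ((√s)⁻¹ • y) (by
      simp only [Pi.smul_apply, smul_eq_mul, mul_pow, ← Finset.mul_sum, ← hs, inv_pow,
        Real.sq_sqrt hpos.le]
      exact inv_mul_cancel₀ hpos.ne')
    rw [quad_smul, inv_pow, Real.sq_sqrt hpos.le, inv_mul_le_iff₀ hpos] at h2
    linarith

/-- The spectral radius of a nonempty graph is the maximum of the Rayleigh quotient, and it has a
nonnegative unit eigenvector. -/
theorem exists_perron_vector [Nonempty V] (G : SimpleGraph V) :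
    ∃ x : V → ℝ, (∀ v, 0 ≤ x v) ∧ ∑ v, x v ^ 2 = 1 ∧
      (∀ u, nbrSum G x u = adjSpectralRadius G * x u) ∧
      ∀ y : V → ℝ, quad G y ≤ adjSpectralRadius G * ∑ v, y v ^ 2 := by
  obtain ⟨x, hx0, hx1, hmax⟩ := exists_nonneg_isMax_quad G
  set μ := quad G x with hμ
  have heig : ∀ u, nbrSum G x u = μ * x u := by
    intro u
    -- perturb the maximizer in the direction of the basis vector at `u`
    set z : V → ℝ := Pi.single u 1 with hz
    have hlin : ∀ t : ℝ, 0 ≤ 2 * (μ * x u - nbrSum G x u) * t + (μ - quad G z) * (t * t) := by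
      intro t
      have h1 := hmax (x + t • z)
      rw [quad_add_smul] at h1
      have h2 : ∑ v, z v * nbrSum G x v = nbrSum G x u := by simp [hz, Pi.single_apply]
      have h3 : ∑ v, (x + t • z) v ^ 2 = 1 + 2 * t * x u + t ^ 2 := by
        have : ∀ v, (x + t • z) v ^ 2 = x v ^ 2 + 2 * t * (x v * z v) + t ^ 2 * z v ^ 2 := by
          intro v
          simp only [Pi.add_apply, Pi.smul_apply, smul_eq_mul]
          ring
        simp only [this, Finset.sum_add_distrib, ← Finset.mul_sum, hx1]
        simp [hz, Pi.single_apply]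
      rw [h2, h3] at h1
      nlinarith
    have hd := discrim_le_zero (a := μ - quad G z) (b := 2 * (μ * x u - nbrSum G x u)) (c := 0)
      (fun t => by linarith [hlin t])
    have : (2 * (μ * x u - nbrSum G x u)) ^ 2 ≤ 0 := by simpa [discrim] using hd
    have h0 := pow_eq_zero_iff (two_ne_zero) |>.mp (le_antisymm this (sq_nonneg _))
    linarith
  have hxne : x ≠ 0 := by
    rintro rfl
    simp at hx1
  have hμspec : μ ∈ spectrum ℝ (G.adjMatrix ℝ) := (mem_spectrum_adjMatrix_iff G μ).mpr ⟨x, hxne, heig⟩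
  have hub : ∀ ν ∈ spectrum ℝ (G.adjMatrix ℝ), ν ≤ μ := by
    intro ν hν
    obtain ⟨y, hy, hyν⟩ := (mem_spectrum_adjMatrix_iff G ν).mp hν
    have h1 := hmax y
    have h2 : quad G y = ν * ∑ v, y v ^ 2 := by
      simp only [quad, hyν, Finset.mul_sum]
      exact Finset.sum_congr rfl fun u _ => by ring
    have hpos : 0 < ∑ v, y v ^ 2 := by
      obtain ⟨v, hv⟩ := Function.ne_iff.mp hy
      exact Finset.sum_pos' (fun i _ => sq_nonneg _) ⟨v, Finset.mem_univ v, sq_pos_of_ne_zero hv⟩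
    rw [h2] at h1
    exact le_of_mul_le_mul_right h1 hpos
  have hρ : adjSpectralRadius G = μ :=
    IsGreatest.csSup_eq ⟨hμspec, hub⟩
  rw [hρ]
  exact ⟨x, hx0, hx1, heig, hmax⟩

lemma adjSpectralRadius_nonneg [Nonempty V] (G : SimpleGraph V) : 0 ≤ adjSpectralRadius G := by
  obtain ⟨x, hx0, hx1, heig, -⟩ := exists_perron_vector G
  by_contra hneg
  have hz : ∀ u, x u = 0 := by
    intro u
    by_contra hu
    have h1 : 0 ≤ nbrSum G x u := Finset.sum_nonneg fun v _ => hx0 v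
    rw [heig u] at h1
    nlinarith [lt_of_le_of_ne (hx0 u) (Ne.symm hu)]
  simp [hz] at hx1

lemma le_adjSpectralRadius_of_eigenvector (G : SimpleGraph V) {μ : ℝ} {x : V → ℝ} (hx : x ≠ 0)
    (h : ∀ u, nbrSum G x u = μ * x u) : μ ≤ adjSpectralRadius G := by
  have : Finite (spectrum ℝ (G.adjMatrix ℝ)) := inferInstance
  exact le_csSup (Set.toFinite _).bddAbove ((mem_spectrum_adjMatrix_iff G μ).mpr ⟨x, hx, h⟩)

lemma spectrum_adjMatrix_subset_of_iso {W : Type*} [Fintype W] {G : SimpleGraph V}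
    {H : SimpleGraph W} (e : G ≃g H) :
    spectrum ℝ (H.adjMatrix ℝ) ⊆ spectrum ℝ (G.adjMatrix ℝ) := by
  intro μ hμ
  obtain ⟨x, hx, h⟩ := (mem_spectrum_adjMatrix_iff H μ).mp hμ
  refine (mem_spectrum_adjMatrix_iff G μ).mpr ⟨x ∘ e, ?_, fun u => ?_⟩
  · intro h0
    apply hx
    ext w
    simpa using congrFun h0 (e.symm w)
  · rw [Function.comp_apply, ← h (e u)]
    simp only [nbrSum, Finset.sum_filter]
    exact Fintype.sum_equiv e.toEquiv _ _ fun v => by simp [e.map_adj_iff]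

lemma adjSpectralRadius_congr {W : Type*} [Fintype W] {G : SimpleGraph V} {H : SimpleGraph W}
    (e : G ≃g H) : adjSpectralRadius G = adjSpectralRadius H := by
  unfold adjSpectralRadius
  rw [(spectrum_adjMatrix_subset_of_iso e.symm).antisymm (spectrum_adjMatrix_subset_of_iso e)]

end Spectral

/-! ### Bounds for the spectral radius -/

section SpectralBounds

open scoped Classical

variable {V : Type*} [Fintype V]

lemma nbrSum_le_sum_sub (G : SimpleGraph V) {x : V → ℝ} (hx : ∀ v, 0 ≤ x v) (u : V) :
    nbrSum G x u ≤ ∑ v, x v - x u := by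
  rw [← Finset.sum_erase_eq_sub (Finset.mem_univ u)]
  refine Finset.sum_le_sum_of_subset_of_nonneg (fun v hv => ?_) fun v _ _ => hx v
  simp only [Finset.mem_filter, Finset.mem_univ, true_and] at hv
  simp [hv.ne']

lemma nbrSum_le_sum_sub_sub (G : SimpleGraph V) {x : V → ℝ} (hx : ∀ v, 0 ≤ x v) {u v : V}
    (huv : u ≠ v) (h : ¬ G.Adj u v) : nbrSum G x u ≤ ∑ v, x v - x u - x v := by
  rw [← Finset.sum_erase_eq_sub (Finset.mem_univ u),
    ← Finset.sum_erase_eq_sub (show v ∈ Finset.univ.erase u by simp [huv.symm])]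
  refine Finset.sum_le_sum_of_subset_of_nonneg (fun w hw => ?_) fun v _ _ => hx v
  simp only [Finset.mem_filter, Finset.mem_univ, true_and] at hw
  have : w ≠ v := by rintro rfl; exact h hw
  simp [hw.ne', this]

/-- If all vertices of degree more than `D` lie in a set of at most `t ≤ D` vertices, then
`ρ(G) ≤ √(t |V|) + D`: the edges meeting that set contribute at most `√(t |V|) + t` to the Rayleigh
quotient, the other edges at most `D`, and these last two parts sit on complementary coordinates. -/
theorem adjSpectralRadius_le_sqrt_add [Nonempty V] (G : SimpleGraph V) (L : Finset V) (t : ℕ)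
    (D : ℝ) (hL : L.card ≤ t) (htD : t ≤ D) (hdeg : ∀ v ∉ L, (G.degree v : ℝ) ≤ D) :
    adjSpectralRadius G ≤ √(t * Fintype.card V) + D := by
  obtain ⟨x, hx0, hx1, heig, -⟩ := exists_perron_vector G
  have hρ : adjSpectralRadius G = ∑ u, x u * nbrSum G x u := by
    simp only [heig]
    calc adjSpectralRadius G = adjSpectralRadius G * ∑ v, x v ^ 2 := by rw [hx1, mul_one]
      _ = _ := by rw [Finset.mul_sum]; exact Finset.sum_congr rfl fun u _ => by ring
  set A := ∑ v ∈ L, x v with hA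
  set B := ∑ v ∈ Lᶜ, x v with hB
  set a := ∑ v ∈ L, x v ^ 2 with ha
  set b := ∑ v ∈ Lᶜ, x v ^ 2 with hb
  have hA0 : 0 ≤ A := Finset.sum_nonneg fun v _ => hx0 v
  have hB0 : 0 ≤ B := Finset.sum_nonneg fun v _ => hx0 v
  have ha0 : 0 ≤ a := Finset.sum_nonneg fun v _ => sq_nonneg _
  have hb0 : 0 ≤ b := Finset.sum_nonneg fun v _ => sq_nonneg _
  have hab : a + b = 1 := by rw [← hx1, ha, hb, Finset.sum_add_sum_compl]
  have hAa : A ^ 2 ≤ t * a := by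
    refine sq_sum_le_card_mul_sum_sq.trans ?_
    gcongr
  have hBb : B ^ 2 ≤ Fintype.card V * b := by
    refine sq_sum_le_card_mul_sum_sq.trans ?_
    gcongr
    exact Finset.card_le_univ _
  have hAB : 2 * (A * B) ≤ √(t * Fintype.card V) := by
    apply Real.le_sqrt_of_sq_le
    have h1 : A ^ 2 * B ^ 2 ≤ (t * a) * (Fintype.card V * b) :=
      mul_le_mul hAa hBb (sq_nonneg _) (by positivity)
    have h2 : 4 * (a * b) ≤ 1 := by nlinarith [sq_nonneg (a - b)]
    have h3 : (0 : ℝ) ≤ t * Fintype.card V := by positivity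
    nlinarith
  have h1 : ∑ u ∈ L, x u * nbrSum G x u ≤ A * (A + B) := by
    rw [hA, Finset.sum_mul]
    refine Finset.sum_le_sum fun u _ => mul_le_mul_of_nonneg_left ?_ (hx0 u)
    have := nbrSum_le_sum_sub G hx0 u
    rw [← Finset.sum_add_sum_compl L x] at this
    linarith [hx0 u]
  have h2 : ∀ u, nbrSum G x u ≤ A + ∑ v ∈ Lᶜ with G.Adj u v, x v := by
    intro u
    have : nbrSum G x u = ∑ v ∈ L with G.Adj u v, x v + ∑ v ∈ Lᶜ with G.Adj u v, x v := by
      simp only [nbrSum, Finset.sum_filter]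
      rw [Finset.sum_add_sum_compl]
    rw [this]
    gcongr
    exact Finset.sum_le_sum_of_subset_of_nonneg (Finset.filter_subset _ _) fun v _ _ => hx0 v
  have h3 : ∑ u ∈ Lᶜ, x u * ∑ v ∈ Lᶜ with G.Adj u v, x v ≤ D * b := by
    -- `2 x_u x_v ≤ x_u² + x_v²` on each edge, so each vertex gets its square at most `D` times
    have hsym : ∑ u ∈ Lᶜ, ∑ v ∈ Lᶜ with G.Adj u v, x v ^ 2
        = ∑ u ∈ Lᶜ, ∑ v ∈ Lᶜ with G.Adj u v, x u ^ 2 := by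
      simp only [Finset.sum_filter]
      rw [Finset.sum_comm]
      simp only [G.adj_comm]
    have hle : ∑ u ∈ Lᶜ, ∑ v ∈ Lᶜ with G.Adj u v, x u ^ 2 ≤ D * b := by
      rw [hb, Finset.mul_sum]
      refine Finset.sum_le_sum fun u hu => ?_
      rw [Finset.sum_const, nsmul_eq_mul]
      refine mul_le_mul_of_nonneg_right ?_ (sq_nonneg _)
      refine le_trans ?_ (hdeg u (Finset.mem_compl.mp hu))
      rw [← SimpleGraph.card_neighborFinset_eq_degree]
      exact_mod_cast Finset.card_le_card fun v hv => by simpa using (Finset.mem_filter.mp hv).2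
    have h4 : 2 * ∑ u ∈ Lᶜ, x u * ∑ v ∈ Lᶜ with G.Adj u v, x v
        ≤ ∑ u ∈ Lᶜ, ∑ v ∈ Lᶜ with G.Adj u v, x u ^ 2
          + ∑ u ∈ Lᶜ, ∑ v ∈ Lᶜ with G.Adj u v, x v ^ 2 := by
      rw [Finset.mul_sum, ← Finset.sum_add_distrib]
      refine Finset.sum_le_sum fun u _ => ?_
      rw [← Finset.sum_add_distrib, Finset.mul_sum, Finset.mul_sum]
      refine Finset.sum_le_sum fun v _ => ?_
      nlinarith [sq_nonneg (x u - x v)]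
    linarith
  have h5 : ∑ u ∈ Lᶜ, x u * nbrSum G x u ≤ A * B + D * b := by
    calc ∑ u ∈ Lᶜ, x u * nbrSum G x u
        ≤ ∑ u ∈ Lᶜ, (x u * A + x u * ∑ v ∈ Lᶜ with G.Adj u v, x v) := by
          refine Finset.sum_le_sum fun u _ => ?_
          rw [← mul_add]
          exact mul_le_mul_of_nonneg_left (h2 u) (hx0 u)
      _ = A * B + ∑ u ∈ Lᶜ, x u * ∑ v ∈ Lᶜ with G.Adj u v, x v := by
          rw [Finset.sum_add_distrib, ← Finset.sum_mul, mul_comm]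
      _ ≤ _ := by linarith
  have h6 : (t : ℝ) * a ≤ D * a := mul_le_mul_of_nonneg_right htD ha0
  rw [hρ, ← Finset.sum_add_sum_compl L]
  nlinarith

/-- Deleting a vertex `w` at which the Perron vector is smallest, in a graph having some vertex of
degree at most `q`. Here `s` is the square of the entry at `w`. -/
theorem exists_vertex_deletion [Nontrivial V] (G : SimpleGraph V) (q : ℝ) (u : V)
    (hu : (G.degree u : ℝ) ≤ q) :
    ∃ (w : V) (s : ℝ), 0 ≤ s ∧ s * Fintype.card V ≤ 1 ∧
      adjSpectralRadius G ^ 2 * s ≤ q * (1 - (Fintype.card V - q) * s) ∧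
      adjSpectralRadius G * (1 - 2 * s) ≤
        adjSpectralRadius (G.induce {v | v ≠ w}) * (1 - s) := by
  obtain ⟨x, hx0, hx1, heig, -⟩ := exists_perron_vector G
  obtain ⟨w, -, hw⟩ := Finset.exists_min_image Finset.univ x ⟨u, Finset.mem_univ u⟩
  replace hw : ∀ v, x w ≤ x v := fun v => hw v (Finset.mem_univ v)
  set ρ := adjSpectralRadius G with hρ
  have hρ0 : 0 ≤ ρ := adjSpectralRadius_nonneg G
  set m : ℝ := ((Fintype.card V : ℕ) : ℝ) with hm
  have hsq : ∀ v, x w ^ 2 ≤ x v ^ 2 := fun v => pow_le_pow_left₀ (hx0 w) (hw v) 2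
  have hsm : x w ^ 2 * m ≤ 1 := by
    rw [← hx1, mul_comm, hm]
    simpa using Finset.card_nsmul_le_sum Finset.univ (fun v => x v ^ 2) (x w ^ 2)
      fun v _ => hsq v
  refine ⟨w, x w ^ 2, sq_nonneg _, hsm, ?_, ?_⟩
  · set d : ℝ := ((G.degree u : ℕ) : ℝ) with hd
    have hd0 : 0 ≤ d := Nat.cast_nonneg _
    have hcard : ((Finset.univ.filter (G.Adj u)).card : ℝ) = d := by
      rw [hd, ← SimpleGraph.card_neighborFinset_eq_degree]
      congr 2
      ext v; simp
    have h1 : (ρ * x w) ^ 2 ≤ d * ∑ v with G.Adj u v, x v ^ 2 := by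
      have h2 : ρ * x w ≤ nbrSum G x u := by
        rw [heig u]
        exact mul_le_mul_of_nonneg_left (hw u) hρ0
      refine (pow_le_pow_left₀ (mul_nonneg hρ0 (hx0 w)) h2 2).trans ?_
      rw [← hcard]
      exact sq_sum_le_card_mul_sum_sq
    have h3 : ∑ v with G.Adj u v, x v ^ 2 ≤ 1 - (m - d) * x w ^ 2 := by
      have h4 := Finset.sum_add_sum_compl (Finset.univ.filter (G.Adj u)) fun v => x v ^ 2
      have h5 := Finset.card_nsmul_le_sum (Finset.univ.filter (G.Adj u))ᶜ (fun v => x v ^ 2)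
        (x w ^ 2) fun v _ => hsq v
      have h6 : (((Finset.univ.filter (G.Adj u))ᶜ.card : ℕ) : ℝ) = m - d := by
        rw [Finset.card_compl, Nat.cast_sub (Finset.card_le_univ _), hcard]
      rw [nsmul_eq_mul, h6] at h5
      rw [hx1] at h4
      linarith
    have h7 : d * (1 - (m - d) * x w ^ 2) ≤ q * (1 - (m - q) * x w ^ 2) := by
      have : 0 ≤ (q - d) * ((1 - x w ^ 2 * m) + (q + d) * x w ^ 2) := by
        have := sq_nonneg (x w)
        refine mul_nonneg (by linarith) (add_nonneg (by linarith) (mul_nonneg (by linarith) this))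
      nlinarith
    have h8 := mul_le_mul_of_nonneg_left h3 hd0
    nlinarith
  · have : Nonempty {v | v ≠ w} := by
      obtain ⟨z, hz⟩ := exists_ne w
      exact ⟨⟨z, hz⟩⟩
    obtain ⟨-, -, -, -, hray⟩ := exists_perron_vector (G.induce {v | v ≠ w})
    have h1 := hray fun v => x v
    have hsub : ∀ f : V → ℝ, ∑ v : {v | v ≠ w}, f v = ∑ v, f v - f w := by
      intro f
      rw [← Finset.sum_erase_eq_sub (Finset.mem_univ w)]
      refine (Finset.sum_subtype _ (fun v => ?_) f).symm
      simp
    have h2 : ∑ v : {v | v ≠ w}, x v ^ 2 = 1 - x w ^ 2 := by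
      rw [hsub fun v => x v ^ 2, hx1]
    have h3 : ∀ u : {v | v ≠ w}, nbrSum (G.induce {v | v ≠ w}) (fun v => x v) u
        = nbrSum G x u - if G.Adj u w then x w else 0 := by
      intro u
      simp only [nbrSum, Finset.sum_filter]
      exact hsub fun v => if G.Adj u v then x v else 0
    have h4 : quad (G.induce {v | v ≠ w}) (fun v => x v) = ρ - 2 * ρ * x w ^ 2 := by
      simp only [quad, h3]
      rw [hsub fun u => x u * (nbrSum G x u - if G.Adj u w then x w else 0)]
      have h5 : ∑ u, x u * (if G.Adj u w then x w else 0) = x w * (ρ * x w) := by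
        rw [← heig w, nbrSum, Finset.sum_filter, Finset.mul_sum]
        refine Finset.sum_congr rfl fun v _ => ?_
        by_cases h : G.Adj v w <;> simp [h, G.adj_comm w v, mul_comm]
      have h6 : ∑ u, x u * nbrSum G x u = ρ := by
        simp only [heig]
        calc _ = ρ * ∑ v, x v ^ 2 := by
              rw [Finset.mul_sum]; exact Finset.sum_congr rfl fun u _ => by ring
          _ = ρ := by rw [hx1, mul_one]
      simp only [mul_sub, Finset.sum_sub_distrib, h5, h6, heig w, G.irrefl, if_false]
      ring
    rw [h4, h2] at h1
    linarith

/-- A vertex cover: every edge has an endpoint in `A`. -/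
def IsCover (G : SimpleGraph V) (A : Finset V) : Prop :=
  ∀ ⦃u v⦄, G.Adj u v → u ∈ A ∨ v ∈ A

/-- A graph with a vertex cover of size `h` has `ρ² ≤ (h - 1) ρ + h (n - h)`; if equality holds, the
vertices of the cover are adjacent to all other vertices. -/
theorem IsCover.adjSpectralRadius_bound [Nonempty V] {G : SimpleGraph V} {A : Finset V}
    (hA : IsCover G A) (hρ : 0 < adjSpectralRadius G) (hA0 : 0 < A.card) :
    adjSpectralRadius G * (adjSpectralRadius G - (A.card - 1)) ≤
        A.card * (Fintype.card V - A.card) ∧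
      (A.card * (Fintype.card V - A.card) ≤
        adjSpectralRadius G * (adjSpectralRadius G - (A.card - 1)) →
        ∀ u ∈ A, ∀ v, u ≠ v → G.Adj u v) := by
  obtain ⟨x, hx0, hx1, heig, -⟩ := exists_perron_vector G
  set ρ := adjSpectralRadius G
  set h : ℝ := ((A.card : ℕ) : ℝ)
  have hh : 0 < h := Nat.cast_pos.mpr hA0
  set m : ℝ := ((Fintype.card V : ℕ) : ℝ)
  set s := ∑ v ∈ A, x v with hs
  set R := ∑ v ∈ Aᶜ, x v with hR
  have hsR : ∑ v, x v = s + R := (Finset.sum_add_sum_compl A x).symm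
  have hs0 : 0 ≤ s := Finset.sum_nonneg fun v _ => hx0 v
  have hR0 : 0 ≤ R := Finset.sum_nonneg fun v _ => hx0 v
  have hout : ∀ v ∈ Aᶜ, nbrSum G x v ≤ s := by
    intro v hv
    refine Finset.sum_le_sum_of_subset_of_nonneg (fun w hw => ?_) fun v _ _ => hx0 v
    simp only [Finset.mem_filter, Finset.mem_univ, true_and] at hw
    exact (hA hw).resolve_left (Finset.mem_compl.mp hv)
  have hin : ∀ u ∈ A, nbrSum G x u ≤ s + R - x u := by
    intro u _
    rw [← hsR]
    exact nbrSum_le_sum_sub G hx0 u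
  have hspos : 0 < s := by
    refine lt_of_le_of_ne hs0 fun h0 => ?_
    have h1 : ∀ v, x v = 0 := by
      intro v
      by_cases hv : v ∈ A
      · exact (Finset.sum_eq_zero_iff_of_nonneg fun v _ => hx0 v).mp h0.symm v hv
      · have h2 := hout v (Finset.mem_compl.mpr hv)
        rw [heig v, ← h0] at h2
        nlinarith [hx0 v]
    simp [h1] at hx1
  have hcompl : ((Aᶜ.card : ℕ) : ℝ) = m - h := by
    rw [Finset.card_compl, Nat.cast_sub (Finset.card_le_univ _)]
  have e1 : ∑ v ∈ Aᶜ, (s - nbrSum G x v) = (m - h) * s - ρ * R := by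
    simp only [Finset.sum_sub_distrib, Finset.sum_const, nsmul_eq_mul, hcompl, heig,
      ← Finset.mul_sum, hR]
  have e2 : ∑ u ∈ A, (s + R - x u - nbrSum G x u) = h * (s + R) - s - ρ * s := by
    simp only [Finset.sum_sub_distrib, Finset.sum_const, nsmul_eq_mul, heig, ← Finset.mul_sum, hs, h]
  have p1 : 0 ≤ ∑ v ∈ Aᶜ, (s - nbrSum G x v) :=
    Finset.sum_nonneg fun v hv => by linarith [hout v hv]
  have p2 : 0 ≤ ∑ u ∈ A, (s + R - x u - nbrSum G x u) :=
    Finset.sum_nonneg fun v hv => by linarith [hin v hv]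
  have key : (h * (m - h) - ρ * (ρ - (h - 1))) * s =
      h * ∑ v ∈ Aᶜ, (s - nbrSum G x v) + ρ * ∑ u ∈ A, (s + R - x u - nbrSum G x u) := by
    rw [e1, e2]; ring
  constructor
  · have : 0 ≤ (h * (m - h) - ρ * (ρ - (h - 1))) * s := by rw [key]; positivity
    linarith [nonneg_of_mul_nonneg_left this hspos]
  · intro hge u hu v huv
    have h0 : (h * (m - h) - ρ * (ρ - (h - 1))) * s ≤ 0 :=
      mul_nonpos_of_nonpos_of_nonneg (by linarith) hs0
    have z1 : ∑ v ∈ Aᶜ, (s - nbrSum G x v) = 0 := by nlinarith [mul_nonneg hρ.le p2]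
    have z2 : ∑ u ∈ A, (s + R - x u - nbrSum G x u) = 0 := by nlinarith [mul_nonneg hh.le p1]
    have q1 := (Finset.sum_eq_zero_iff_of_nonneg fun v hv => by linarith [hout v hv]).mp z1
    have q2 := (Finset.sum_eq_zero_iff_of_nonneg fun v hv => by linarith [hin v hv]).mp z2
    by_contra hnadj
    have hxv : x v = 0 := by
      have h1 := nbrSum_le_sum_sub_sub G hx0 huv hnadj
      rw [hsR] at h1
      linarith [q2 u hu, hx0 v]
    have h2 := heig v
    rw [hxv, mul_zero] at h2
    by_cases hv : v ∈ A
    · linarith [q2 v hv]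
    · linarith [q1 v (Finset.mem_compl.mpr hv)]

/-- The lower bound for the spectral radius of `S_{n,h}`, from the eigenvector that is constant on
the clique and on the independent set. -/
theorem adjSpectralRadius_completeSplit (n h : ℕ) (hh : 1 ≤ h) (hn : h < n) :
    (h : ℝ) * (n - h) ≤ adjSpectralRadius (completeSplit n h) *
      (adjSpectralRadius (completeSplit n h) - (h - 1)) := by
  have hh' : (1 : ℝ) ≤ h := by exact_mod_cast hh
  have hn' : (h : ℝ) ≤ n := by exact_mod_cast hn.le
  set S := √(((h : ℝ) - 1) ^ 2 + 4 * (h * (n - h))) with hS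
  have hc : 0 ≤ (h : ℝ) * (n - h) := mul_nonneg (by linarith) (by linarith)
  have hS2 : S ^ 2 = ((h : ℝ) - 1) ^ 2 + 4 * (h * (n - h)) := Real.sq_sqrt (by positivity)
  have hSge : (h : ℝ) - 1 ≤ S := Real.le_sqrt_of_sq_le (by linarith)
  set μ : ℝ := ((h : ℝ) - 1 + S) / 2 with hμ
  have hμ2 : μ * (μ - (h - 1)) = h * (n - h) := by
    rw [hμ]; linear_combination hS2 / 4
  have hle : μ ≤ adjSpectralRadius (completeSplit n h) := by
    refine le_adjSpectralRadius_of_eigenvector _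
      (x := Sum.elim (fun _ => μ) (fun _ => (h : ℝ))) ?_ ?_
    · intro h0
      have h1 := congrFun h0 (Sum.inr ⟨0, by omega⟩)
      simp only [Sum.elim_inr, Pi.zero_apply] at h1
      linarith
    · rintro (i | j)
      · have : nbrSum (completeSplit n h) (Sum.elim (fun _ => μ) (fun _ => (h : ℝ))) (Sum.inl i)
            = (h - 1) * μ + (n - h) * h := by
          have h1 : ∑ j : Fin h, (if i = j then (0 : ℝ) else μ) = (h - 1) * μ := by
            rw [Finset.sum_ite]
            simp [Finset.filter_not, Finset.filter_eq, Finset.card_sdiff, Nat.cast_sub hh]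
          simp [nbrSum, Finset.sum_filter, completeSplit, join, Nat.cast_sub hn.le, h1]
        rw [this, Sum.elim_inl]
        linarith
      · simp [nbrSum, Finset.sum_filter, completeSplit, join, mul_comm]
  nlinarith

end SpectralBounds

/-! ### Paths and their vertex sets -/

section Paths

open scoped Classical

variable {V : Type*}

/-- `s` is the vertex set of a path of `G` with ends `a` and `b`; the path is recorded as the list of
its vertices. -/
def PathOn (G : SimpleGraph V) (a b : V) (s : Finset V) : Prop :=
  ∃ l : List V, l.Nodup ∧ l.IsChain G.Adj ∧ l.head? = some a ∧ l.getLast? = some b ∧ l.toFinset = s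

variable {G : SimpleGraph V} {a b c d : V} {s t : Finset V}

lemma PathOn.single (a : V) : PathOn G a a {a} :=
  ⟨[a], by simp, by simp, by simp, by simp, by simp⟩

lemma PathOn.symm (h : PathOn G a b s) : PathOn G b a s := by
  obtain ⟨l, h1, h2, h3, h4, h5⟩ := h
  refine ⟨l.reverse, List.nodup_reverse.mpr h1, ?_, by simpa using h4, by simpa using h3,
    by simpa using h5⟩
  rw [List.isChain_reverse]
  exact h2.imp fun _ _ h => h.symm

lemma PathOn.left_mem (h : PathOn G a b s) : a ∈ s := by
  obtain ⟨l, -, -, h3, -, rfl⟩ := h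
  exact List.mem_toFinset.mpr (List.mem_of_mem_head? h3)

lemma PathOn.right_mem (h : PathOn G a b s) : b ∈ s := h.symm.left_mem

lemma PathOn.append (h : PathOn G a b s) (h' : PathOn G c d t) (hbc : G.Adj b c)
    (hst : Disjoint s t) : PathOn G a d (s ∪ t) := by
  obtain ⟨l, h1, h2, h3, h4, rfl⟩ := h
  obtain ⟨l', h1', h2', h3', h4', rfl⟩ := h'
  refine ⟨l ++ l', ?_, ?_, ?_, ?_, by simp⟩
  · refine List.Nodup.append h1 h1' fun x hx hx' => ?_
    exact Finset.disjoint_left.mp hst (List.mem_toFinset.mpr hx) (List.mem_toFinset.mpr hx')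
  · refine h2.append h2' ?_
    simp [h4, h3', hbc]
  · simp [h3]
  · simp [h4']

/-- A path closed up to a cycle can be opened at any of its vertices. -/
lemma PathOn.rotate (h : PathOn G a b s) (hab : G.Adj b a) (hc : c ∈ s) :
    ∃ d, PathOn G c d s := by
  obtain ⟨l, h1, h2, h3, h4, rfl⟩ := h
  obtain ⟨l₁, l₂, rfl⟩ := List.append_of_mem (List.mem_toFinset.mp hc)
  have hne : c :: l₂ ++ l₁ ≠ [] := by simp
  refine ⟨(c :: l₂ ++ l₁).getLast hne, c :: l₂ ++ l₁, ?_, ?_, by simp,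
    List.getLast?_eq_some_getLast hne, ?_⟩
  · exact List.nodup_append_comm.mp h1
  · obtain ⟨g1, g2, -⟩ := List.isChain_append.mp h2
    refine g2.append g1 fun x hx y hy => ?_
    have hx' : x = b := by
      rw [List.getLast?_append_of_ne_nil _ (by simp)] at h4
      rw [h4] at hx
      simpa using hx.symm
    have hy' : y = a := by
      cases l₁ with
      | nil => simp at hy
      | cons z l₁ =>
        simp at h3 hy
        rw [← hy, h3]
    rw [hx', hy']
    exact hab
  · ext; simp; tauto

/-- If the end `b` of a path is adjacent to all its other vertices, any vertex of the path can be
made the new end, keeping the vertex set, with the other end being `a` or `b`. -/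
lemma PathOn.change_end (h : PathOn G a b s) (hb : ∀ x ∈ s, x ≠ b → G.Adj x b) (hc : c ∈ s) :
    ∃ a', (a' = a ∨ a' = b) ∧ PathOn G a' c s := by
  obtain ⟨l, h1, h2, h3, h4, rfl⟩ := h
  obtain ⟨l₁, l₂, rfl⟩ := List.append_of_mem (List.mem_toFinset.mp hc)
  obtain ⟨g1, g2, -⟩ := List.isChain_append.mp h2
  rw [List.getLast?_append_of_ne_nil _ (by simp)] at h4
  have hbm : b ∈ c :: l₂ := List.mem_of_getLast? h4
  have g2' : (c :: l₂).reverse.IsChain G.Adj := by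
    rw [List.isChain_reverse]
    exact g2.imp fun _ _ h => h.symm
  have hhead : (c :: l₂).reverse.head? = some b := by rw [List.head?_reverse, h4]
  have hlast : (c :: l₂).reverse.getLast? = some c := by simp
  cases l₁ with
  | nil =>
    refine ⟨b, Or.inr rfl, (c :: l₂).reverse, List.nodup_reverse.mpr (by simpa using h1), g2',
      hhead, hlast, ?_⟩
    ext; simp
  | cons z l₁ =>
    refine ⟨a, Or.inl rfl, (z :: l₁) ++ (c :: l₂).reverse, ?_, ?_, by simpa using h3, ?_, ?_⟩
    · rw [List.nodup_append] at h1 ⊢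
      refine ⟨h1.1, List.nodup_reverse.mpr h1.2.1, fun x hx y hy => h1.2.2 x hx y ?_⟩
      exact List.mem_reverse.mp hy
    · refine g1.append g2' fun x hx y hy => ?_
      rw [hhead] at hy
      obtain rfl : b = y := by simpa using hy
      have hx' : x ∈ z :: l₁ := List.mem_of_getLast? hx
      refine hb x (List.mem_toFinset.mpr (List.mem_append_left _ hx')) ?_
      exact (List.nodup_append.mp h1).2.2 x hx' b hbm
    · rw [List.getLast?_append_of_ne_nil _ (by simp), hlast]
    · ext; simp

/-- `v 0, …, v p` is a path. -/
structure IsPathSeq (G : SimpleGraph V) (p : ℕ) (v : ℕ → V) : Prop where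
  inj : ∀ ⦃i j⦄, i ≤ p → j ≤ p → v i = v j → i = j
  adj : ∀ ⦃i⦄, i < p → G.Adj (v i) (v (i + 1))

/-- The set of vertices `v i, …, v j` of a sequence. -/
noncomputable def seg (v : ℕ → V) (i j : ℕ) : Finset V := (Finset.Icc i j).image v

lemma mem_seg {v : ℕ → V} {i j : ℕ} {x : V} : x ∈ seg v i j ↔ ∃ k, i ≤ k ∧ k ≤ j ∧ v k = x := by
  simp [seg, and_assoc]

lemma PathOn.exists_seq (h : PathOn G a b s) :
    ∃ p v, IsPathSeq G p v ∧ v 0 = a ∧ v p = b ∧ s = seg v 0 p ∧ s.card = p + 1 := by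
  obtain ⟨l, h1, h2, h3, h4, rfl⟩ := h
  have hpos : 0 < l.length := List.length_pos_of_mem (List.mem_of_mem_head? h3)
  have hget : ∀ i (hi : i < l.length), l.getD i a = l[i] := fun i hi => by
    simp [hi]
  refine ⟨l.length - 1, fun i => l.getD i a, ⟨fun i j hi hj hij => ?_, fun i hi => ?_⟩, ?_, ?_, ?_, ?_⟩
  · rw [hget i (by omega), hget j (by omega)] at hij
    exact (h1.getElem_inj_iff).mp hij
  · rw [hget i (by omega), hget (i + 1) (by omega)]
    exact List.isChain_iff_getElem.mp h2 i (by omega)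
  · have : l[0]? = some a := by rwa [← List.head?_eq_getElem?]
    simp [this]
  · rw [List.getLast?_eq_getElem?] at h4
    simp [h4]
  · ext x
    rw [List.mem_toFinset, List.mem_iff_getElem, mem_seg]
    constructor
    · rintro ⟨i, hi, rfl⟩
      exact ⟨i, by omega, by omega, hget i hi⟩
    · rintro ⟨i, -, hi, rfl⟩
      exact ⟨i, by omega, (hget i (by omega)).symm⟩
  · rw [List.toFinset_card_of_nodup h1]; omega

lemma seg_disjoint {p : ℕ} {v : ℕ → V} (h : IsPathSeq G p v) {i j i' j' : ℕ} (hj : j < i')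
    (hj' : j' ≤ p) : Disjoint (seg v i j) (seg v i' j') := by
  rw [Finset.disjoint_left]
  intro x hx hx'
  obtain ⟨k, h1, h2, rfl⟩ := mem_seg.mp hx
  obtain ⟨k', h1', h2', h3⟩ := mem_seg.mp hx'
  have := h.inj (by omega) (by omega) h3
  omega

lemma card_seg {p : ℕ} {v : ℕ → V} (h : IsPathSeq G p v) (i : ℕ) {j : ℕ} (hj : j ≤ p) :
    (seg v i j).card = j + 1 - i := by
  rw [seg, Finset.card_image_of_injOn, Nat.card_Icc]
  intro x hx y hy hxy
  simp only [Finset.coe_Icc, Set.mem_Icc] at hx hy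
  exact h.inj (by omega) (by omega) hxy

lemma IsPathSeq.pathOn {p : ℕ} {v : ℕ → V} (h : IsPathSeq G p v) {i j : ℕ} (hij : i ≤ j)
    (hj : j ≤ p) : PathOn G (v i) (v j) (seg v i j) := by
  induction j, hij using Nat.le_induction with
  | base => simpa [seg] using PathOn.single (G := G) (v i)
  | succ j hij ih =>
    have h1 := (ih (by omega)).append (PathOn.single (v (j + 1))) (h.adj (by omega)) (by
      rw [Finset.disjoint_singleton_right, mem_seg]
      rintro ⟨k, h1, h2, h3⟩
      have := h.inj (by omega) hj h3
      omega)
    have h2 : seg v i j ∪ {v (j + 1)} = seg v i (j + 1) := by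
      rw [seg, seg, ← Finset.insert_Icc_right_eq_Icc_add_one (by omega), Finset.image_insert,
        Finset.union_comm, Finset.insert_eq]
    rwa [h2] at h1

/-- In a graph whose degrees are at least `r`, greedy extension gives paths with up to `r + 1` vertices
from any starting vertex. -/
lemma exists_pathOn_of_degree [Fintype V] {r : ℕ} (hr : ∀ v, r ≤ G.degree v) (a : V) {k : ℕ}
    (hk : k ≤ r) : ∃ b s, PathOn G a b s ∧ s.card = k + 1 := by
  induction k with
  | zero => exact ⟨a, {a}, PathOn.single a, by simp⟩
  | succ k ih =>
    obtain ⟨b, s, h, hs⟩ := ih (by omega)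
    have : ∃ c ∈ G.neighborFinset b, c ∉ s.erase b := by
      apply Finset.exists_mem_notMem_of_card_lt_card
      rw [Finset.card_erase_of_mem h.right_mem, SimpleGraph.card_neighborFinset_eq_degree]
      have := hr b
      omega
    obtain ⟨c, hc, hcs⟩ := this
    rw [SimpleGraph.mem_neighborFinset] at hc
    have hcs' : c ∉ s := fun h' => hcs (Finset.mem_erase.mpr ⟨hc.ne', h'⟩)
    refine ⟨c, s ∪ {c}, h.append (PathOn.single c) hc (by simpa using hcs'), ?_⟩
    rw [Finset.card_union_of_disjoint (by simpa using hcs')]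
    simp [hs]

lemma PathOn.reachable (h : PathOn G a b s) (hc : c ∈ s) (hd : d ∈ s) : G.Reachable c d := by
  obtain ⟨p, v, hv, rfl, rfl, rfl, -⟩ := h.exists_seq
  have key : ∀ i, i ≤ p → G.Reachable (v 0) (v i) := by
    intro i hi
    induction i with
    | zero => exact SimpleGraph.Reachable.refl _
    | succ i ih => exact (ih (by omega)).trans (hv.adj (by omega)).reachable
  obtain ⟨i, -, hi, rfl⟩ := mem_seg.mp hc
  obtain ⟨j, -, hj, rfl⟩ := mem_seg.mp hd
  exact (key i hi).symm.trans (key j hj)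

lemma mem_of_reachable_of_closed {Q : Set V} (hQ : ∀ x ∈ Q, ∀ y, G.Adj x y → y ∈ Q)
    (h : G.Reachable a b) (ha : a ∈ Q) : b ∈ Q := by
  obtain ⟨w⟩ := h
  induction w with
  | nil => exact ha
  | cons hadj _ ih => exact ih (hQ _ ha _ hadj)

end Paths

/-! ### Longest paths in graphs of large minimum degree -/

section LongestPath

open scoped Classical

variable {V : Type*} {G : SimpleGraph V} {p r : ℕ} {v : ℕ → V}

/-- `v 0, …, v p` is a path which is longest among all paths that share a vertex with it. -/
structure IsLongestPath (G : SimpleGraph V) (p : ℕ) (v : ℕ → V) : Prop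
    extends IsPathSeq G p v where
  card_le : ∀ ⦃a b s i⦄, PathOn G a b s → i ≤ p → v i ∈ s → s.card ≤ p + 1

/-- Every connected component is visited by a path that is longest in it. -/
lemma exists_isLongestPath [Fintype V] (G : SimpleGraph V) (b : V) :
    ∃ p v, IsLongestPath G p v ∧ G.Reachable b (v 0) := by
  obtain ⟨s, hs, hmax⟩ := Finset.exists_max_image
    (Finset.univ.filter fun s : Finset V => ∃ a c, PathOn G a c s ∧ G.Reachable b a) Finset.card
    ⟨{b}, Finset.mem_filter.mpr ⟨Finset.mem_univ _, b, b, PathOn.single b, .refl _⟩⟩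
  simp only [Finset.mem_filter, Finset.mem_univ, true_and] at hs hmax
  obtain ⟨a, c, hp, hba⟩ := hs
  obtain ⟨p, v, hv, rfl, rfl, rfl, hc⟩ := hp.exists_seq
  refine ⟨p, v, ⟨hv, fun a' c' t i ht hi hvi => ?_⟩, hba⟩
  rw [← hc]
  refine hmax t ⟨a', c', ht, hba.trans ?_⟩
  exact (hp.reachable hp.left_mem (mem_seg.mpr ⟨i, by omega, hi, rfl⟩)).trans
    (ht.reachable hvi ht.left_mem)

lemma mem_seg_self {i j k : ℕ} (h1 : i ≤ k) (h2 : k ≤ j) : v k ∈ seg v i j :=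
  mem_seg.mpr ⟨k, h1, h2, rfl⟩

lemma notMem_seg_of_notMem {w : V} (hw : w ∉ seg v 0 p) {i j : ℕ} (hj : j ≤ p) :
    w ∉ seg v i j := fun h => by
  obtain ⟨k, h1, h2, h3⟩ := mem_seg.mp h
  exact hw (mem_seg.mpr ⟨k, by omega, by omega, h3⟩)

namespace IsLongestPath

lemma not_adj_first (h : IsLongestPath G p v) {w : V} (hw : w ∉ seg v 0 p) : ¬ G.Adj w (v 0) := by
  intro hadj
  have h1 := (PathOn.single w).append (h.pathOn (Nat.zero_le p) le_rfl) hadj (by simpa using hw)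
  have h2 := h.card_le h1 le_rfl (Finset.mem_union_right _ (mem_seg_self (Nat.zero_le p) le_rfl))
  rw [Finset.card_union_of_disjoint (by simpa using hw), card_seg h.toIsPathSeq _ le_rfl] at h2
  simp at h2

lemma not_adj_last (h : IsLongestPath G p v) {w : V} (hw : w ∉ seg v 0 p) : ¬ G.Adj w (v p) := by
  intro hadj
  have h1 := (PathOn.single w).append (h.pathOn (Nat.zero_le p) le_rfl).symm hadj
    (by simpa using hw)
  have h2 := h.card_le h1 le_rfl (Finset.mem_union_right _ (mem_seg_self (Nat.zero_le p) le_rfl))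
  rw [Finset.card_union_of_disjoint (by simpa using hw), card_seg h.toIsPathSeq _ le_rfl] at h2
  simp at h2

/-- If the path can be left, its vertices do not span a cycle. -/
lemma no_crossing (h : IsLongestPath G p v) {w : V} (hw : w ∉ seg v 0 p) {k : ℕ} (hk : k ≤ p)
    (hkw : G.Adj (v k) w) {i : ℕ} (hi : i < p) (h0 : G.Adj (v 0) (v (i + 1)))
    (hp : G.Adj (v i) (v p)) : False := by
  have hd : Disjoint (seg v 0 i) (seg v (i + 1) p) :=
    seg_disjoint h.toIsPathSeq (by omega) le_rfl
  have h1 := (h.pathOn (Nat.zero_le i) hi.le).append (h.pathOn (show i + 1 ≤ p by omega) le_rfl).symm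
    hp hd
  have hmem : ∀ {j}, j ≤ p → v j ∈ seg v 0 i ∪ seg v (i + 1) p := by
    intro j hj
    rcases le_or_gt j i with hji | hji
    · exact Finset.mem_union_left _ (mem_seg_self (Nat.zero_le j) hji)
    · exact Finset.mem_union_right _ (mem_seg_self hji hj)
  obtain ⟨d, h2⟩ := h1.rotate h0.symm (hmem hk)
  have hwd : Disjoint {w} (seg v 0 i ∪ seg v (i + 1) p) := by
    rw [Finset.disjoint_singleton_left, Finset.mem_union, not_or]
    exact ⟨notMem_seg_of_notMem hw hi.le, notMem_seg_of_notMem hw le_rfl⟩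
  have h3 := (PathOn.single w).append h2 hkw.symm hwd
  have h4 := h.card_le h3 hk (Finset.mem_union_right _ (hmem hk))
  rw [Finset.card_union_of_disjoint hwd, Finset.card_union_of_disjoint hd,
    card_seg h.toIsPathSeq _ hi.le, card_seg h.toIsPathSeq _ le_rfl] at h4
  simp only [Finset.card_singleton] at h4
  omega

lemma degree_first_le [Fintype V] (h : IsLongestPath G p v) :
    G.degree (v 0) ≤ ((Finset.range p).filter fun i => G.Adj (v 0) (v (i + 1))).card := by
  rw [← SimpleGraph.card_neighborFinset_eq_degree]
  refine le_trans (Finset.card_le_card ?_) (Finset.card_image_le (f := fun i => v (i + 1)))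
  intro x hx
  rw [SimpleGraph.mem_neighborFinset] at hx
  have hxs : x ∈ seg v 0 p := by
    by_contra hxs
    exact h.not_adj_first hxs hx.symm
  obtain ⟨k, -, hk, rfl⟩ := mem_seg.mp hxs
  cases k with
  | zero => exact absurd hx (G.irrefl)
  | succ k =>
    exact Finset.mem_image.mpr ⟨k, by simpa using ⟨by omega, hx⟩, rfl⟩

lemma degree_last_le [Fintype V] (h : IsLongestPath G p v) :
    G.degree (v p) ≤ ((Finset.range p).filter fun i => G.Adj (v i) (v p)).card := by
  rw [← SimpleGraph.card_neighborFinset_eq_degree]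
  refine le_trans (Finset.card_le_card ?_) (Finset.card_image_le (f := fun i => v i))
  intro x hx
  rw [SimpleGraph.mem_neighborFinset] at hx
  have hxs : x ∈ seg v 0 p := by
    by_contra hxs
    exact h.not_adj_last hxs hx.symm
  obtain ⟨k, -, hk, rfl⟩ := mem_seg.mp hxs
  have hkp : k ≠ p := by rintro rfl; exact G.irrefl hx
  exact Finset.mem_image.mpr ⟨k, by simpa using ⟨by omega, hx.symm⟩, rfl⟩

/-- Crossing-free chords at the two ends: a longest path that can be left has at least `2r + 1`
vertices when all degrees are at least `r`. -/
lemma two_mul_le [Fintype V] (h : IsLongestPath G p v) (hr : ∀ x, r ≤ G.degree x) {w : V}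
    (hw : w ∉ seg v 0 p) {k : ℕ} (hk : k ≤ p) (hkw : G.Adj (v k) w) : 2 * r ≤ p := by
  have h1 := (hr _).trans h.degree_first_le
  have h2 := (hr _).trans h.degree_last_le
  have hd : Disjoint ((Finset.range p).filter fun i => G.Adj (v 0) (v (i + 1)))
      ((Finset.range p).filter fun i => G.Adj (v i) (v p)) := by
    rw [Finset.disjoint_left]
    intro i hi hi'
    rw [Finset.mem_filter, Finset.mem_range] at hi hi'
    exact h.no_crossing hw hk hkw hi.1 hi.2 hi'.2
  have h3 := Finset.card_le_card (Finset.union_subset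
    (Finset.filter_subset (fun i => G.Adj (v 0) (v (i + 1))) (Finset.range p))
    (Finset.filter_subset (fun i => G.Adj (v i) (v p)) (Finset.range p)))
  rw [Finset.card_union_of_disjoint hd, Finset.card_range] at h3
  omega

/-- When the path has exactly `2r + 1` vertices, the chords at the two ends are complementary. -/
lemma adj_first_or_last [Fintype V] (h : IsLongestPath G (2 * r) v) (hr : ∀ x, r ≤ G.degree x)
    {w : V} (hw : w ∉ seg v 0 (2 * r)) {k : ℕ} (hk : k ≤ 2 * r) (hkw : G.Adj (v k) w)
    {i : ℕ} (hi : i < 2 * r) : G.Adj (v 0) (v (i + 1)) ∨ G.Adj (v i) (v (2 * r)) := by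
  have h1 := (hr _).trans h.degree_first_le
  have h2 := (hr _).trans h.degree_last_le
  have hd : Disjoint ((Finset.range (2 * r)).filter fun i => G.Adj (v 0) (v (i + 1)))
      ((Finset.range (2 * r)).filter fun i => G.Adj (v i) (v (2 * r))) := by
    rw [Finset.disjoint_left]
    intro i hi hi'
    rw [Finset.mem_filter, Finset.mem_range] at hi hi'
    exact h.no_crossing hw hk hkw hi.1 hi.2 hi'.2
  have h3 := Finset.eq_of_subset_of_card_le (Finset.union_subset
    (Finset.filter_subset (fun i => G.Adj (v 0) (v (i + 1))) (Finset.range (2 * r)))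
    (Finset.filter_subset (fun i => G.Adj (v i) (v (2 * r))) (Finset.range (2 * r)))) (by
      rw [Finset.card_union_of_disjoint hd, Finset.card_range]
      omega)
  have h4 : i ∈ Finset.range (2 * r) := Finset.mem_range.mpr hi
  rw [← h3, Finset.mem_union, Finset.mem_filter, Finset.mem_filter] at h4
  tauto

/-- A path vertex with a neighbour outside the path is adjacent to both ends of the path. -/
lemma adj_ends_of_attached [Fintype V] (h : IsLongestPath G (2 * r) v)
    (hr : ∀ x, r ≤ G.degree x) {w : V} (hw : w ∉ seg v 0 (2 * r)) {i : ℕ} (hi : i ≤ 2 * r)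
    (hiw : G.Adj (v i) w) :
    0 < i ∧ i < 2 * r ∧ G.Adj (v 0) (v i) ∧ G.Adj (v i) (v (2 * r)) := by
  have hi0 : i ≠ 0 := by
    rintro rfl; exact h.not_adj_first hw hiw.symm
  have hip : i ≠ 2 * r := by
    rintro rfl; exact h.not_adj_last hw hiw.symm
  refine ⟨by omega, by omega, ?_, ?_⟩
  · have h1 := h.adj_first_or_last hr hw hi hiw (i := i - 1) (by omega)
    rw [Nat.sub_add_cancel (by omega)] at h1
    refine h1.resolve_right fun h2 => ?_
    have d1 : Disjoint (seg v i (2 * r)) (seg v 0 (i - 1)) :=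
      (seg_disjoint h.toIsPathSeq (by omega) le_rfl).symm
    have p1 := (h.pathOn hi le_rfl).append (h.pathOn (Nat.zero_le (i - 1)) (by omega)).symm
      h2.symm d1
    have d2 : Disjoint {w} (seg v i (2 * r) ∪ seg v 0 (i - 1)) := by
      rw [Finset.disjoint_singleton_left, Finset.mem_union, not_or]
      exact ⟨notMem_seg_of_notMem hw le_rfl, notMem_seg_of_notMem hw (by omega)⟩
    have p2 := (PathOn.single w).append p1 hiw.symm d2
    have h4 := h.card_le p2 hi (Finset.mem_union_right _ (Finset.mem_union_left _
      (mem_seg_self le_rfl hi)))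
    rw [Finset.card_union_of_disjoint d2, Finset.card_union_of_disjoint d1,
      card_seg h.toIsPathSeq _ le_rfl, card_seg h.toIsPathSeq _ (by omega)] at h4
    simp only [Finset.card_singleton] at h4
    omega
  · refine (h.adj_first_or_last hr hw hi hiw (i := i) (by omega)).resolve_left fun h2 => ?_
    have d1 : Disjoint (seg v 0 i) (seg v (i + 1) (2 * r)) :=
      seg_disjoint h.toIsPathSeq (by omega) le_rfl
    have p1 := (h.pathOn (Nat.zero_le i) hi).symm.append
      (h.pathOn (show i + 1 ≤ 2 * r by omega) le_rfl) h2 d1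
    have d2 : Disjoint {w} (seg v 0 i ∪ seg v (i + 1) (2 * r)) := by
      rw [Finset.disjoint_singleton_left, Finset.mem_union, not_or]
      exact ⟨notMem_seg_of_notMem hw hi, notMem_seg_of_notMem hw le_rfl⟩
    have p2 := (PathOn.single w).append p1 hiw.symm d2
    have h4 := h.card_le p2 hi (Finset.mem_union_right _ (Finset.mem_union_left _
      (mem_seg_self (Nat.zero_le i) le_rfl)))
    rw [Finset.card_union_of_disjoint d2, Finset.card_union_of_disjoint d1,
      card_seg h.toIsPathSeq _ le_rfl, card_seg h.toIsPathSeq _ hi] at h4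
    simp only [Finset.card_singleton] at h4
    omega

/-- Two consecutive path vertices do not both have neighbours outside the path. -/
lemma not_attached_succ [Fintype V] (h : IsLongestPath G (2 * r) v)
    (hr : ∀ x, r ≤ G.degree x) {w w' : V} (hw : w ∉ seg v 0 (2 * r)) (hw' : w' ∉ seg v 0 (2 * r))
    {i : ℕ} (hi : i + 1 ≤ 2 * r) (hiw : G.Adj (v i) w) (hiw' : G.Adj (v (i + 1)) w') : False := by
  have h1 := h.adj_ends_of_attached hr hw (by omega) hiw
  have h2 := h.adj_ends_of_attached hr hw' hi hiw'
  exact h.no_crossing hw (by omega) hiw (by omega) h2.2.2.1 h1.2.2.2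

end IsLongestPath

/-- A set of integers in `[a, b]` without two consecutive elements has at most `(b - a + 2) / 2`
elements. -/
lemma two_mul_card_le_of_no_consecutive {T : Finset ℕ} {a b : ℕ} (hT : T ⊆ Finset.Icc a b)
    (h : ∀ i ∈ T, i + 1 ∉ T) : 2 * T.card ≤ b + 2 - a := by
  have hd : Disjoint T (T.image (· + 1)) := by
    rw [Finset.disjoint_right]
    intro x hx
    obtain ⟨i, hi, rfl⟩ := Finset.mem_image.mp hx
    exact h i hi
  have hsub : T ∪ T.image (· + 1) ⊆ Finset.Icc a (b + 1) := by
    intro x hx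
    rcases Finset.mem_union.mp hx with hx | hx
    · have := Finset.mem_Icc.mp (hT hx)
      exact Finset.mem_Icc.mpr (by omega)
    · obtain ⟨i, hi, rfl⟩ := Finset.mem_image.mp hx
      have := Finset.mem_Icc.mp (hT hi)
      exact Finset.mem_Icc.mpr (by omega)
  have hc := Finset.card_le_card hsub
  rw [Finset.card_union_of_disjoint hd, Finset.card_image_of_injective _ (add_left_injective 1),
    Nat.card_Icc] at hc
  omega

/-- A set of `r` integers in `[1, 2r - 1]` without two consecutive elements contains all the odd
ones. -/
lemma odd_mem_of_no_consecutive {T : Finset ℕ} {r : ℕ} (hT : ∀ i ∈ T, 1 ≤ i ∧ i < 2 * r)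
    (h : ∀ i ∈ T, i + 1 ∉ T) (hr : r ≤ T.card) {k : ℕ} (hk : k < r) : 2 * k + 1 ∈ T := by
  have hd : Disjoint T (T.image (· + 1)) := by
    rw [Finset.disjoint_right]
    intro x hx
    obtain ⟨i, hi, rfl⟩ := Finset.mem_image.mp hx
    exact h i hi
  have hsub : T ∪ T.image (· + 1) ⊆ Finset.Icc 1 (2 * r) := by
    intro x hx
    rcases Finset.mem_union.mp hx with hx | hx
    · have := hT x hx
      exact Finset.mem_Icc.mpr (by omega)
    · obtain ⟨i, hi, rfl⟩ := Finset.mem_image.mp hx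
      have := hT i hi
      exact Finset.mem_Icc.mpr (by omega)
  have heq := Finset.eq_of_subset_of_card_le hsub (by
    rw [Finset.card_union_of_disjoint hd, Finset.card_image_of_injective _ (add_left_injective 1),
      Nat.card_Icc]
    omega)
  have key : ∀ j, 1 ≤ j → j ≤ 2 * r → j ∈ T ∨ j - 1 ∈ T := by
    intro j h1 h2
    have hj : j ∈ Finset.Icc 1 (2 * r) := Finset.mem_Icc.mpr ⟨h1, h2⟩
    rw [← heq, Finset.mem_union, Finset.mem_image] at hj
    rcases hj with hj | ⟨i, hi, rfl⟩
    · exact Or.inl hj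
    · exact Or.inr hi
  induction k with
  | zero =>
    rcases key 1 le_rfl (by omega) with h1 | h1
    · exact h1
    · have := hT _ h1; omega
  | succ k ih =>
    rcases key (2 * (k + 1) + 1) (by omega) (by omega) with h1 | h1
    · exact h1
    · exact absurd h1 (h _ (ih (by omega)))

namespace IsLongestPath

/-- If some vertex off a longest path with `2r + 1` vertices has all its neighbours on the path, the
path vertices of odd index form a vertex cover. -/
theorem isCover_of_neighbors_on_path [Fintype V] (h : IsLongestPath G (2 * r) v)
    (hr : ∀ x, r ≤ G.degree x) (hG : G.Preconnected) {w : V} (hw : w ∉ seg v 0 (2 * r))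
    (hwN : ∀ y, G.Adj w y → y ∈ seg v 0 (2 * r)) :
    IsCover G ((Finset.range r).image fun k => v (2 * k + 1)) := by
  have hps := h.toIsPathSeq
  have hodd : ∀ k, k < r → G.Adj (v (2 * k + 1)) w := by
    intro k hk
    set T := (Finset.range (2 * r + 1)).filter fun i => G.Adj (v i) w with hT
    have hmem : ∀ i, i ∈ T ↔ i ≤ 2 * r ∧ G.Adj (v i) w := by
      intro i; simp [hT]
    have := odd_mem_of_no_consecutive (T := T) (r := r) (fun i hi => ?_) (fun i hi hi' => ?_) ?_ hk
    · exact ((hmem _).mp this).2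
    · have h1 := (hmem i).mp hi
      have := h.adj_ends_of_attached hr hw h1.1 h1.2
      omega
    · have h1 := (hmem i).mp hi
      have h2 := (hmem _).mp hi'
      exact h.not_attached_succ hr hw hw h2.1 h1.2 h2.2
    · refine (hr w).trans ?_
      rw [← SimpleGraph.card_neighborFinset_eq_degree]
      refine (Finset.card_le_card ?_).trans (Finset.card_image_le (f := v))
      intro y hy
      rw [SimpleGraph.mem_neighborFinset] at hy
      obtain ⟨i, -, hi, rfl⟩ := mem_seg.mp (hwN y hy)
      exact Finset.mem_image.mpr ⟨i, (hmem i).mpr ⟨hi, hy.symm⟩, rfl⟩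
  have hends : ∀ k, k < r → G.Adj (v 0) (v (2 * k + 1)) ∧ G.Adj (v (2 * k + 1)) (v (2 * r)) :=
    fun k hk => (h.adj_ends_of_attached hr hw (by omega) (hodd k hk)).2.2
  have hnotmem : ∀ x, x ∉ (Finset.range r).image (fun k => v (2 * k + 1)) →
      x ∈ seg v 0 (2 * r) → ∃ a, a ≤ r ∧ v (2 * a) = x := by
    intro x hx hxs
    obtain ⟨i, -, hi, rfl⟩ := mem_seg.mp hxs
    rcases Nat.even_or_odd' i with ⟨a, rfl | rfl⟩
    · exact ⟨a, by omega, rfl⟩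
    · exact absurd (Finset.mem_image.mpr ⟨a, Finset.mem_range.mpr (by omega), rfl⟩) hx
  -- path vertices of even index are pairwise non-adjacent
  have heven : ∀ a b, a < b → b ≤ r → ¬ G.Adj (v (2 * a)) (v (2 * b)) := by
    intro a b hab hb hadj
    rcases hb.lt_or_eq with hb | rfl
    · have d1 : Disjoint (seg v 0 (2 * a)) (seg v (2 * b + 1) (2 * r)) :=
        seg_disjoint hps (by omega) le_rfl
      have p1 := (h.pathOn (Nat.zero_le (2 * a)) (by omega)).symm.append
        (h.pathOn (show 2 * b + 1 ≤ 2 * r by omega) le_rfl) (hends b hb).1 d1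
      have d2 : Disjoint (seg v (2 * a + 1) (2 * b))
          (seg v 0 (2 * a) ∪ seg v (2 * b + 1) (2 * r)) :=
        Finset.disjoint_union_right.mpr ⟨(seg_disjoint hps (by omega) (by omega)).symm,
          seg_disjoint hps (by omega) le_rfl⟩
      have p2 := (h.pathOn (show 2 * a + 1 ≤ 2 * b by omega) (by omega)).append p1 hadj.symm d2
      have d3 : Disjoint {w} (seg v (2 * a + 1) (2 * b) ∪
          (seg v 0 (2 * a) ∪ seg v (2 * b + 1) (2 * r))) := by
        rw [Finset.disjoint_singleton_left, Finset.mem_union, Finset.mem_union, not_or, not_or]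
        exact ⟨notMem_seg_of_notMem hw (by omega), notMem_seg_of_notMem hw (by omega),
          notMem_seg_of_notMem hw le_rfl⟩
      have p3 := (PathOn.single w).append p2 (hodd a (by omega)).symm d3
      have hc := h.card_le p3 (i := 2 * b) (by omega)
        (Finset.mem_union_right _ (Finset.mem_union_left _ (mem_seg_self (by omega) le_rfl)))
      rw [Finset.card_union_of_disjoint d3, Finset.card_union_of_disjoint d2,
        Finset.card_union_of_disjoint d1, card_seg hps _ (by omega), card_seg hps _ (by omega),
        card_seg hps _ le_rfl] at hc
      simp only [Finset.card_singleton] at hc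
      omega
    · exact h.no_crossing hw (by omega) (hodd a hab) (by omega) (hends a hab).1 hadj
  -- a vertex off the path has all its neighbours on the path
  have hout : ∀ x y, x ∉ seg v 0 (2 * r) → y ∉ seg v 0 (2 * r) → ¬ G.Adj x y := by
    by_contra! hcon
    obtain ⟨x₀, y₀, hx₀, hy₀, hadj₀⟩ := hcon
    by_cases hatt : ∃ x y i, x ∉ seg v 0 (2 * r) ∧ y ∉ seg v 0 (2 * r) ∧ G.Adj x y ∧ i ≤ 2 * r ∧
        G.Adj (v i) x
    · obtain ⟨x, y, i, hx, hy, hxy, hi, hix⟩ := hatt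
      have hi' := h.adj_ends_of_attached hr hx hi hix
      rcases Nat.even_or_odd' i with ⟨a, rfl | rfl⟩
      · refine h.not_attached_succ hr hx hw (i := 2 * a) (by omega) hix (hodd a (by omega))
      · have d0 : Disjoint ({x} : Finset V) (seg v 0 (2 * a + 1)) := by
          rw [Finset.disjoint_singleton_left]
          exact notMem_seg_of_notMem hx (by omega)
        rcases Nat.lt_or_ge (a + 1) r with har | har
        · have d1 : Disjoint (seg v 0 (2 * a + 1)) (seg v (2 * (a + 1) + 1) (2 * r)) :=
            seg_disjoint hps (by omega) le_rfl
          have p1 := (h.pathOn (Nat.zero_le (2 * a + 1)) (by omega)).symm.append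
            (h.pathOn (show 2 * (a + 1) + 1 ≤ 2 * r by omega) le_rfl) (hends (a + 1) har).1 d1
          have d2 : Disjoint {x} (seg v 0 (2 * a + 1) ∪ seg v (2 * (a + 1) + 1) (2 * r)) := by
            rw [Finset.disjoint_singleton_left, Finset.mem_union, not_or]
            exact ⟨notMem_seg_of_notMem hx (by omega), notMem_seg_of_notMem hx le_rfl⟩
          have p2 := (PathOn.single x).append p1 hix.symm d2
          have d3 : Disjoint {y} ({x} ∪ (seg v 0 (2 * a + 1) ∪ seg v (2 * (a + 1) + 1) (2 * r))) := by
            rw [Finset.disjoint_singleton_left, Finset.mem_union, Finset.mem_union, not_or, not_or,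
              Finset.mem_singleton]
            exact ⟨hxy.ne', notMem_seg_of_notMem hy (by omega), notMem_seg_of_notMem hy le_rfl⟩
          have p3 := (PathOn.single y).append p2 hxy.symm d3
          have hc := h.card_le p3 (i := 2 * a + 1) (by omega)
            (Finset.mem_union_right _ (Finset.mem_union_right _ (Finset.mem_union_left _
              (mem_seg_self (by omega) le_rfl))))
          rw [Finset.card_union_of_disjoint d3, Finset.card_union_of_disjoint d2,
            Finset.card_union_of_disjoint d1, card_seg hps _ (by omega),
            card_seg hps _ le_rfl] at hc
          simp only [Finset.card_singleton] at hc
          omega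
        · have p2 := (PathOn.single x).append
            (h.pathOn (Nat.zero_le (2 * a + 1)) (by omega)).symm hix.symm d0
          have d3 : Disjoint {y} ({x} ∪ seg v 0 (2 * a + 1)) := by
            rw [Finset.disjoint_singleton_left, Finset.mem_union, not_or, Finset.mem_singleton]
            exact ⟨hxy.ne', notMem_seg_of_notMem hy (by omega)⟩
          have p3 := (PathOn.single y).append p2 hxy.symm d3
          have hc := h.card_le p3 (i := 2 * a + 1) (by omega)
            (Finset.mem_union_right _ (Finset.mem_union_right _ (mem_seg_self (by omega) le_rfl)))
          rw [Finset.card_union_of_disjoint d3, Finset.card_union_of_disjoint d0,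
            card_seg hps _ (by omega)] at hc
          simp only [Finset.card_singleton] at hc
          omega
    · -- the vertices with a neighbour off the path would form a union of components
      push Not at hatt
      have := mem_of_reachable_of_closed
        (Q := {x | x ∉ seg v 0 (2 * r) ∧ ∃ y, y ∉ seg v 0 (2 * r) ∧ G.Adj x y}) ?_ (hG x₀ (v 0))
        ⟨hx₀, y₀, hy₀, hadj₀⟩
      · exact this.1 (mem_seg_self le_rfl (Nat.zero_le _))
      · rintro x ⟨hx, y, hy, hxy⟩ z hxz
        have hz : z ∉ seg v 0 (2 * r) := by
          intro hz
          obtain ⟨i, -, hi, rfl⟩ := mem_seg.mp hz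
          exact hatt x y i hx hy hxy hi hxz.symm
        exact ⟨hz, x, hx, hxz.symm⟩
  intro x y hxy
  by_contra! hcon
  obtain ⟨hx, hy⟩ := hcon
  -- the neighbours on the path of a vertex off the path have odd index
  have hmix : ∀ x y, x ∉ (Finset.range r).image (fun k => v (2 * k + 1)) → x ∈ seg v 0 (2 * r) →
      y ∉ seg v 0 (2 * r) → ¬ G.Adj x y := by
    intro x y hx hxs hys hxy
    obtain ⟨a, ha, rfl⟩ := hnotmem x hx hxs
    have := h.adj_ends_of_attached hr hys (by omega) hxy
    exact h.not_attached_succ hr hys hw (i := 2 * a) (by omega) hxy (hodd a (by omega))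
  by_cases hxs : x ∈ seg v 0 (2 * r) <;> by_cases hys : y ∈ seg v 0 (2 * r)
  · obtain ⟨a, ha, rfl⟩ := hnotmem x hx hxs
    obtain ⟨b, hb, rfl⟩ := hnotmem y hy hys
    rcases lt_trichotomy a b with hab | rfl | hab
    · exact heven a b hab hb hxy
    · exact G.irrefl hxy
    · exact heven b a hab ha hxy.symm
  · exact hmix x y hx hxs hys hxy
  · exact hmix y x hy hys hxs hxy.symm
  · exact hout x y hxs hys hxy

end IsLongestPath

end LongestPath

/-! ### Tails of a longest path -/

section Tails

open scoped Classical

variable {V : Type*} {G : SimpleGraph V} {r : ℕ} {v : ℕ → V}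

/-- A set of `r` vertices none of which has a neighbour outside the set, except possibly `x`. -/
def IsBlock (G : SimpleGraph V) (r : ℕ) (x : V) (s : Finset V) : Prop :=
  s.card = r ∧ ∀ u ∈ s, ∀ y, G.Adj u y → y ∈ s ∨ y = x

namespace IsLongestPath

/-- A path off the longest path, attached to it at `v i`, is no longer than either part of the
longest path at `v i`. -/
lemma tail_card_le {p : ℕ} (h : IsLongestPath G p v) {s : Finset V} {a b : V} (hs : PathOn G a b s)
    (hdisj : Disjoint s (seg v 0 p)) {i : ℕ} (hi : i ≤ p) (hia : G.Adj (v i) a) :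
    s.card ≤ i ∧ s.card ≤ p - i := by
  have hps := h.toIsPathSeq
  have hsub : ∀ {j k}, k ≤ p → Disjoint s (seg v j k) := fun hk =>
    Finset.disjoint_left.mpr fun x hx => notMem_seg_of_notMem (Finset.disjoint_left.mp hdisj hx) hk
  constructor
  · have p1 := hs.symm.append (h.pathOn hi le_rfl) hia.symm (hsub le_rfl)
    have hc := h.card_le p1 hi (Finset.mem_union_right _ (mem_seg_self le_rfl hi))
    rw [Finset.card_union_of_disjoint (hsub le_rfl), card_seg hps _ le_rfl] at hc
    omega
  · have p1 := hs.symm.append (h.pathOn (Nat.zero_le i) hi).symm hia.symm (hsub hi)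
    have hc := h.card_le p1 hi (Finset.mem_union_right _ (mem_seg_self (Nat.zero_le i) le_rfl))
    rw [Finset.card_union_of_disjoint (hsub hi), card_seg hps _ hi] at hc
    omega

/-- A path off the longest path that joins `v i` and `v j` is no longer than the part of the longest
path strictly between them. -/
lemma detour_card_lt {p : ℕ} (h : IsLongestPath G p v) {s : Finset V} {a b : V}
    (hs : PathOn G a b s) (hdisj : Disjoint s (seg v 0 p)) {i j : ℕ} (hij : i < j) (hj : j ≤ p)
    (hia : G.Adj (v i) a) (hjb : G.Adj (v j) b) : i + s.card < j := by
  have hps := h.toIsPathSeq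
  have hsub : ∀ {j k}, k ≤ p → Disjoint s (seg v j k) := fun hk =>
    Finset.disjoint_left.mpr fun x hx => notMem_seg_of_notMem (Finset.disjoint_left.mp hdisj hx) hk
  have p1 := hs.append (h.pathOn hj le_rfl) hjb.symm (hsub le_rfl)
  have d2 : Disjoint (seg v 0 i) (s ∪ seg v j p) :=
    Finset.disjoint_union_right.mpr ⟨(hsub (by omega)).symm, seg_disjoint hps hij le_rfl⟩
  have p2 := (h.pathOn (Nat.zero_le i) (by omega)).append p1 hia d2
  have hc := h.card_le p2 hj (Finset.mem_union_right _ (Finset.mem_union_right _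
    (mem_seg_self le_rfl hj)))
  rw [Finset.card_union_of_disjoint d2, Finset.card_union_of_disjoint (hsub le_rfl),
    card_seg hps _ le_rfl, card_seg hps _ (by omega)] at hc
  omega

/-- A path `a … z` off the longest path, attached to it at `v i`, with at least two vertices and
such that `z` has no further neighbours off the longest path. Then counting the neighbours of `z`
forces the tail to have `r` vertices, to hang from the middle of the longest path, and `z` to be
adjacent to the whole tail and to the middle vertex. -/
lemma tail_end_neighbors [Fintype V] (h : IsLongestPath G (2 * r) v) (hr : ∀ x, r ≤ G.degree x)
    {s : Finset V} {a z : V} (hs : PathOn G a z s) (hdisj : Disjoint s (seg v 0 (2 * r))) {i : ℕ}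
    (hi : i ≤ 2 * r) (hia : G.Adj (v i) a) (hcard : 2 ≤ s.card)
    (hz : ∀ y, G.Adj z y → y ∈ s ∨ y ∈ seg v 0 (2 * r)) :
    i = r ∧ s.card = r ∧ G.neighborFinset z = insert (v r) (s.erase z) := by
  have hzP : z ∉ seg v 0 (2 * r) := Finset.disjoint_left.mp hdisj hs.right_mem
  have haP : a ∉ seg v 0 (2 * r) := Finset.disjoint_left.mp hdisj hs.left_mem
  set T := (Finset.range (2 * r + 1)).filter fun j => G.Adj (v j) z with hT
  have hmem : ∀ j, j ∈ T ↔ j ≤ 2 * r ∧ G.Adj (v j) z := by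
    intro i; simp [hT]
  have hsub : G.neighborFinset z ⊆ s.erase z ∪ T.image v := by
    intro y hy
    rw [SimpleGraph.mem_neighborFinset] at hy
    rcases hz y hy with hy' | hy'
    · exact Finset.mem_union_left _ (Finset.mem_erase.mpr ⟨hy.ne', hy'⟩)
    · obtain ⟨j, -, hj, rfl⟩ := mem_seg.mp hy'
      exact Finset.mem_union_right _ (Finset.mem_image.mpr ⟨j, (hmem j).mpr ⟨hj, hy.symm⟩, rfl⟩)
  have hdeg : r ≤ (s.card - 1) + T.card := by
    refine (hr z).trans ?_
    rw [← SimpleGraph.card_neighborFinset_eq_degree, ← Finset.card_erase_of_mem hs.right_mem]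
    refine (Finset.card_le_card hsub).trans ((Finset.card_union_le _ _).trans ?_)
    exact Nat.add_le_add_left Finset.card_image_le _
  have hlen := h.tail_card_le hs hdisj hi hia
  have hTcons : ∀ j ∈ T, j + 1 ∉ T := by
    intro j hj hj'
    have h1 := (hmem _).mp hj
    have h2 := (hmem _).mp hj'
    exact h.not_attached_succ hr hzP hzP h2.1 h1.2 h2.2
  set T₁ := T.filter (· < i) with hT₁
  set T₂ := T.filter (i < ·) with hT₂
  have hT₁sub : ∀ j ∈ T₁, s.card ≤ j ∧ j + s.card < i := by
    intro j hj
    rw [hT₁, Finset.mem_filter] at hj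
    have h1 := (hmem j).mp hj.1
    exact ⟨(h.tail_card_le hs.symm hdisj h1.1 h1.2).1,
      h.detour_card_lt hs.symm hdisj hj.2 hi h1.2 hia⟩
  have hT₂sub : ∀ j ∈ T₂, i + s.card < j ∧ j + s.card ≤ 2 * r := by
    intro j hj
    rw [hT₂, Finset.mem_filter] at hj
    have h1 := (hmem j).mp hj.1
    have h2 := (h.tail_card_le hs.symm hdisj h1.1 h1.2).2
    exact ⟨h.detour_card_lt hs hdisj hj.2 h1.1 hia h1.2, by omega⟩
  have hc₁ : 2 * T₁.card ≤ (i - s.card - 1) + 2 - s.card :=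
    two_mul_card_le_of_no_consecutive
      (fun j hj => by have := hT₁sub j hj; exact Finset.mem_Icc.mpr (by omega))
      (fun j hj hj' => hTcons j (Finset.mem_of_mem_filter j hj) (Finset.mem_of_mem_filter _ hj'))
  have hc₂ : 2 * T₂.card ≤ (2 * r - s.card) + 2 - (i + s.card + 1) :=
    two_mul_card_le_of_no_consecutive
      (fun j hj => by have := hT₂sub j hj; exact Finset.mem_Icc.mpr (by omega))
      (fun j hj hj' => hTcons j (Finset.mem_of_mem_filter j hj) (Finset.mem_of_mem_filter _ hj'))
  have hTsub : T ⊆ (T₁ ∪ T₂) ∪ {i} := by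
    intro j hj
    rcases lt_trichotomy j i with hji | rfl | hji
    · exact Finset.mem_union_left _ (Finset.mem_union_left _ (Finset.mem_filter.mpr ⟨hj, hji⟩))
    · exact Finset.mem_union_right _ (Finset.mem_singleton_self _)
    · exact Finset.mem_union_left _ (Finset.mem_union_right _ (Finset.mem_filter.mpr ⟨hj, hji⟩))
  have hTc : T.card ≤ T₁.card + T₂.card + 1 := by
    refine (Finset.card_le_card hTsub).trans ((Finset.card_union_le _ _).trans ?_)
    simpa using Finset.card_union_le T₁ T₂
  have e₁ : T₁ = ∅ := by
    by_contra hne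
    obtain ⟨j, hj⟩ := Finset.nonempty_iff_ne_empty.mpr hne
    have b₁ := hT₁sub j hj
    by_cases hne₂ : T₂ = ∅
    · rw [hne₂, Finset.card_empty] at hTc
      omega
    · obtain ⟨j', hj'⟩ := Finset.nonempty_iff_ne_empty.mpr hne₂
      have b₂ := hT₂sub j' hj'
      omega
  have e₂ : T₂ = ∅ := by
    by_contra hne
    obtain ⟨j, hj⟩ := Finset.nonempty_iff_ne_empty.mpr hne
    have b₂ := hT₂sub j hj
    rw [e₁, Finset.card_empty] at hTc
    omega
  rw [e₁, e₂, Finset.card_empty] at hTc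
  have hir : i = r := by omega
  have hsr : s.card = r := by omega
  subst hir
  refine ⟨rfl, hsr, ?_⟩
  have hsub' : G.neighborFinset z ⊆ insert (v i) (s.erase z) := by
    refine hsub.trans ?_
    rw [e₁, e₂] at hTsub
    intro y hy
    rcases Finset.mem_union.mp hy with hy | hy
    · exact Finset.mem_insert_of_mem hy
    · obtain ⟨j, hj, rfl⟩ := Finset.mem_image.mp hy
      have : j = i := by simpa using hTsub hj
      rw [this]
      exact Finset.mem_insert_self _ _
  refine Finset.eq_of_subset_of_card_le hsub' ?_
  rw [SimpleGraph.card_neighborFinset_eq_degree]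
  refine (Finset.card_insert_le _ _).trans ?_
  rw [Finset.card_erase_of_mem hs.right_mem]
  have := hr z
  omega

/-- Let `Q` be a union of components of the graph off the longest path, without isolated vertices
and attached to the longest path. Then `Q` contains a block hanging from the middle of the
longest path, namely the vertex set of a longest tail. -/
lemma exists_block [Fintype V] (h : IsLongestPath G (2 * r) v) (hr : ∀ x, r ≤ G.degree x)
    {Q : Set V} (hQP : ∀ x ∈ Q, x ∉ seg v 0 (2 * r))
    (hQ : ∀ x ∈ Q, ∀ y, y ∉ seg v 0 (2 * r) → G.Adj x y → y ∈ Q)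
    (hQ' : ∀ x ∈ Q, ∃ y, y ∉ seg v 0 (2 * r) ∧ G.Adj x y)
    {x₀ : V} (hx₀ : x₀ ∈ Q) {i₀ : ℕ} (hi₀ : i₀ ≤ 2 * r) (hadj₀ : G.Adj (v i₀) x₀) :
    ∃ s : Finset V, s.Nonempty ∧ (∀ x ∈ s, x ∈ Q) ∧ IsBlock G r (v r) s := by
  obtain ⟨y₀, hy₀, hxy₀⟩ := hQ' x₀ hx₀
  have hy₀Q := hQ x₀ hx₀ y₀ hy₀ hxy₀
  have ht₀ : PathOn G x₀ y₀ ({x₀} ∪ {y₀}) :=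
    (PathOn.single x₀).append (PathOn.single y₀) hxy₀ (by simpa using hxy₀.ne)
  have hmem₀ : ({x₀} ∪ {y₀} : Finset V) ∈ Finset.univ.filter fun s : Finset V =>
      (∀ x ∈ s, x ∈ Q) ∧ ∃ a b i, PathOn G a b s ∧ i ≤ 2 * r ∧ G.Adj (v i) a := by
    refine Finset.mem_filter.mpr ⟨Finset.mem_univ _, ?_, x₀, y₀, i₀, ht₀, hi₀, hadj₀⟩
    intro x hx
    simp only [Finset.mem_union, Finset.mem_singleton] at hx
    rcases hx with rfl | rfl
    · exact hx₀
    · exact hy₀Q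
  obtain ⟨s, hs, hmax⟩ := Finset.exists_max_image _ Finset.card ⟨_, hmem₀⟩
  have hcard : 2 ≤ s.card := by
    have := hmax _ hmem₀
    rwa [Finset.card_union_of_disjoint (by simpa using hxy₀.ne)] at this
  obtain ⟨-, hsQ, a, z, i, hp, hi, hia⟩ := Finset.mem_filter.mp hs
  have hdisj : Disjoint s (seg v 0 (2 * r)) := Finset.disjoint_left.mpr fun x hx => hQP x (hsQ x hx)
  -- a tail on `s` cannot be extended off the longest path
  have hend : ∀ {a z i}, PathOn G a z s → i ≤ 2 * r → G.Adj (v i) a →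
      i = r ∧ s.card = r ∧ G.neighborFinset z = insert (v r) (s.erase z) := by
    intro a z i hp hi hia
    refine h.tail_end_neighbors hr hp hdisj hi hia hcard fun y hy => ?_
    by_contra! hcon
    have hyQ := hQ z (hsQ z hp.right_mem) y hcon.2 hy
    have hd : Disjoint s {y} := by simpa using hcon.1
    have := hmax (s ∪ {y}) (Finset.mem_filter.mpr ⟨Finset.mem_univ _, fun x hx => ?_, a, y, i,
      hp.append (PathOn.single y) hy hd, hi, hia⟩)
    · rw [Finset.card_union_of_disjoint hd, Finset.card_singleton] at this
      omega
    · rcases Finset.mem_union.mp hx with hx | hx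
      · exact hsQ x hx
      · rw [Finset.mem_singleton.mp hx]
        exact hyQ
  obtain ⟨rfl, hsr, hN⟩ := hend hp hi hia
  refine ⟨s, ⟨a, hp.left_mem⟩, hsQ, hsr, fun u hu y huy => ?_⟩
  have hzadj : ∀ x, G.Adj z x ↔ x = v i ∨ x ≠ z ∧ x ∈ s := fun x => by
    rw [← SimpleGraph.mem_neighborFinset, hN, Finset.mem_insert, Finset.mem_erase]
  obtain ⟨a', ha', hp'⟩ := hp.change_end
    (fun x hx hxz => ((hzadj x).mpr (Or.inr ⟨hxz, hx⟩)).symm) hu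
  have hia' : G.Adj (v i) a' := by
    rcases ha' with rfl | rfl
    · exact hia
    · exact ((hzadj _).mpr (Or.inl rfl)).symm
  have hNu := (hend hp' hi hia').2.2
  rw [← SimpleGraph.mem_neighborFinset, hNu, Finset.mem_insert, Finset.mem_erase] at huy
  tauto

/-- If every vertex off the path has a neighbour off the path, then the vertices off the path lie in
blocks hanging from the middle vertex, which is therefore the only vertex of degree more than
`2r`. -/
theorem eq_middle_of_degree [Fintype V] (h : IsLongestPath G (2 * r) v) (hr : ∀ x, r ≤ G.degree x)
    (hG : G.Preconnected)
    (hN : ∀ w, w ∉ seg v 0 (2 * r) → ∃ y, y ∉ seg v 0 (2 * r) ∧ G.Adj w y) {b : V}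
    (hb : 2 * r < G.degree b) : b = v r := by
  have hblock : ∀ x, x ∉ seg v 0 (2 * r) → ∃ s, IsBlock G r (v r) s ∧ x ∈ s := by
    by_contra! hcon
    obtain ⟨x₀, hx₀, hx₀s⟩ := hcon
    -- the set of vertices off the path and in no block is a union of components off the path
    set Q : Set V := {x | x ∉ seg v 0 (2 * r) ∧ ∀ s, IsBlock G r (v r) s → x ∉ s} with hQdef
    have hmid : v r ∈ seg v 0 (2 * r) := mem_seg_self (Nat.zero_le r) (by omega)
    have hQ : ∀ x ∈ Q, ∀ y, y ∉ seg v 0 (2 * r) → G.Adj x y → y ∈ Q := by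
      rintro x ⟨hx, hxs⟩ y hy hxy
      refine ⟨hy, fun s hs hys => ?_⟩
      rcases hs.2 y hys x hxy.symm with h1 | rfl
      · exact hxs s hs h1
      · exact hx hmid
    by_cases hatt : ∃ x ∈ Q, ∃ i ≤ 2 * r, G.Adj (v i) x
    · obtain ⟨x, hx, i, hi, hix⟩ := hatt
      obtain ⟨s, ⟨u, hu⟩, hsQ, hs⟩ := h.exists_block hr (Q := Q) (fun x hx => hx.1) hQ
        (fun x hx => hN x hx.1) hx hi hix
      exact (hsQ u hu).2 s hs hu
    · push Not at hatt
      have := mem_of_reachable_of_closed (Q := Q) ?_ (hG x₀ (v 0)) ⟨hx₀, hx₀s⟩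
      · exact this.1 (mem_seg_self le_rfl (Nat.zero_le _))
      · intro x hx y hxy
        refine hQ x hx y (fun hy => ?_) hxy
        obtain ⟨i, -, hi, rfl⟩ := mem_seg.mp hy
        exact hatt x hx i hi hxy.symm
  have hbdeg : ∀ s : Finset V, (∀ y, G.Adj b y → y ∈ s) → 2 * r < s.card := fun s hs =>
    lt_of_lt_of_le hb <| by
      rw [← SimpleGraph.card_neighborFinset_eq_degree]
      exact Finset.card_le_card fun y hy => hs y (by simpa using hy)
  by_cases hbP : b ∈ seg v 0 (2 * r)
  · have hout : ∃ w, w ∉ seg v 0 (2 * r) ∧ G.Adj b w := by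
      by_contra! hcon
      have h1 := hbdeg ((seg v 0 (2 * r)).erase b) fun y hy => by
        refine Finset.mem_erase.mpr ⟨hy.ne', ?_⟩
        by_contra hy'
        exact hcon y hy' hy
      rw [Finset.card_erase_of_mem hbP, card_seg h.toIsPathSeq _ le_rfl] at h1
      omega
    obtain ⟨w, hw, hbw⟩ := hout
    obtain ⟨s, hs, hws⟩ := hblock w hw
    rcases hs.2 w hws b hbw.symm with h1 | h1
    · -- a block containing `b` has too few vertices to hold its neighbours
      have h2 := hbdeg (insert (v r) (s.erase b)) fun y hy => by
        rcases hs.2 b h1 y hy with h3 | h3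
        · exact Finset.mem_insert_of_mem (Finset.mem_erase.mpr ⟨hy.ne', h3⟩)
        · rw [h3]; exact Finset.mem_insert_self _ _
      have h3 := Finset.card_insert_le (v r) (s.erase b)
      have h4 := Finset.card_pos.mpr ⟨b, h1⟩
      rw [Finset.card_erase_of_mem h1] at h3
      have := hs.1
      omega
    · exact h1
  · obtain ⟨s, hs, hbs⟩ := hblock b hbP
    have h2 := hbdeg (insert (v r) (s.erase b)) fun y hy => by
      rcases hs.2 b hbs y hy with h3 | h3
      · exact Finset.mem_insert_of_mem (Finset.mem_erase.mpr ⟨hy.ne', h3⟩)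
      · rw [h3]; exact Finset.mem_insert_self _ _
    have h3 := Finset.card_insert_le (v r) (s.erase b)
    have h4 := Finset.card_pos.mpr ⟨b, hbs⟩
    rw [Finset.card_erase_of_mem hbs] at h3
    have := hs.1
    omega

/-- A longest path with at most `2r + 1` vertices can be left if its component has a vertex of degree
more than `2r`. -/
lemma exists_attached_of_degree [Fintype V] {p : ℕ} (h : IsLongestPath G p v) {b : V}
    (hbv : G.Reachable b (v 0)) (hb : 2 * r < G.degree b) (hp : p ≤ 2 * r) :
    ∃ w, w ∉ seg v 0 p ∧ ∃ k ≤ p, G.Adj (v k) w := by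
  have hps := h.toIsPathSeq
  by_contra! hcon
  have hclosed : ∀ x ∈ {x | x ∈ seg v 0 p}, ∀ y, G.Adj x y → y ∈ {x | x ∈ seg v 0 p} := by
    intro x hx y hxy
    obtain ⟨k, -, hk, rfl⟩ := mem_seg.mp hx
    by_contra hy
    exact hcon y hy k hk hxy
  have hbs : b ∈ seg v 0 p :=
    mem_of_reachable_of_closed hclosed hbv.symm (mem_seg_self le_rfl (Nat.zero_le p))
  have h1 : G.neighborFinset b ⊆ (seg v 0 p).erase b := fun y hy => by
    rw [SimpleGraph.mem_neighborFinset] at hy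
    exact Finset.mem_erase.mpr ⟨hy.ne', hclosed b hbs y hy⟩
  have h2 := Finset.card_le_card h1
  rw [Finset.card_erase_of_mem hbs, card_seg hps _ le_rfl,
    SimpleGraph.card_neighborFinset_eq_degree] at h2
  omega

/-- A component with a vertex of degree more than `2r` has a path on `2r + 1` vertices. -/
lemma two_mul_le_of_degree [Fintype V] {p : ℕ} (h : IsLongestPath G p v)
    (hr : ∀ x, r ≤ G.degree x) {b : V} (hbv : G.Reachable b (v 0)) (hb : 2 * r < G.degree b) :
    2 * r ≤ p := by
  by_contra hp
  obtain ⟨w, hw, k, hk, hkw⟩ := h.exists_attached_of_degree hbv hb (by omega)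
  exact hp (h.two_mul_le hr hw hk hkw)

end IsLongestPath

/-- A connected graph with all degrees at least `r`, with two vertices of degree more than `2r`, and
without a path on `2r + 2` vertices has a vertex cover of size `r`. -/
theorem exists_isCover_of_connected [Fintype V] (hG : G.Preconnected) (hr : ∀ x, r ≤ G.degree x)
    {b b' : V} (hbb : b ≠ b') (hb : 2 * r < G.degree b) (hb' : 2 * r < G.degree b')
    (hpath : ∀ a c s, PathOn G a c s → s.card < 2 * r + 2) :
    ∃ A : Finset V, A.card = r ∧ IsCover G A := by
  obtain ⟨p, v, h, -⟩ := exists_isLongestPath G b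
  have hps := h.toIsPathSeq
  have hp : p ≤ 2 * r := by
    have := hpath _ _ _ (h.pathOn (Nat.zero_le p) le_rfl)
    rw [card_seg hps _ le_rfl] at this
    omega
  obtain ⟨w, hw, k, hk, hkw⟩ := h.exists_attached_of_degree (hG _ _) hb hp
  obtain rfl : p = 2 * r := le_antisymm hp (h.two_mul_le hr hw hk hkw)
  by_cases hN : ∀ w, w ∉ seg v 0 (2 * r) → ∃ y, y ∉ seg v 0 (2 * r) ∧ G.Adj w y
  · exact absurd ((h.eq_middle_of_degree hr hG hN hb).trans
      (h.eq_middle_of_degree hr hG hN hb').symm) hbb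
  · push Not at hN
    obtain ⟨w, hw, hwN⟩ := hN
    refine ⟨_, ?_, h.isCover_of_neighbors_on_path hr hG hw fun y hy => ?_⟩
    · rw [Finset.card_image_of_injOn, Finset.card_range]
      intro i hi j hj hij
      simp only [Finset.coe_range, Set.mem_Iio] at hi hj
      have := h.inj (by omega) (by omega) hij
      omega
    · by_contra hy'
      exact hwN y hy' hy

end Tails

/-! ### Star-path forests -/

section Forest

open scoped Classical

/-- The values `w 0, …, w (m * k - 1)` are the vertices of `k` disjoint paths with `m` vertices each,
one path after the other. -/
structure IsPathForestSeq {V : Type*} (G : SimpleGraph V) (m k : ℕ) (w : ℕ → V) : Prop where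
  inj : ∀ ⦃i j⦄, i < m * k → j < m * k → w i = w j → i = j
  adj : ∀ ⦃i⦄, i + 1 < m * k → ¬ m ∣ i + 1 → G.Adj (w i) (w (i + 1))

variable {V : Type*} {G : SimpleGraph V} {k₁ k₂ ℓ : ℕ}

/-- The forest has `k₁ + ℓ k₂` disjoint edges, so it is not contained in a graph with a smaller vertex
cover. -/
theorem IsCover.starPathForest_free {A : Finset V} (hA : IsCover G A) (hℓ : 1 ≤ ℓ)
    (hcard : A.card < k₁ + ℓ * k₂) : (starPathForest k₁ k₂ ℓ).Free G := by
  rintro ⟨φ⟩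
  have hstar : ∀ a : Fin k₁, G.Adj (φ (Sum.inl (a, 0)))
      (φ (Sum.inl (a, ⟨1, by omega⟩))) := by
    intro a
    refine φ.toHom.map_adj ?_
    have h1 : (starS (2 * ℓ - 1)).Adj 0 ⟨1, by omega⟩ :=
      SimpleGraph.starGraph_center_adj fun h => by simpa using congrArg Fin.val h
    simpa [starPathForest, copies] using h1
  have hpath : ∀ x : Fin k₂ × Fin ℓ, G.Adj (φ (Sum.inr (x.1, ⟨2 * x.2, by omega⟩)))
      (φ (Sum.inr (x.1, ⟨2 * x.2 + 1, by omega⟩))) := by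
    intro x
    refine φ.toHom.map_adj ?_
    simp [starPathForest, copies, SimpleGraph.pathGraph_adj]
  have hφ : Function.Injective φ := φ.injective
  set g : Fin k₁ ⊕ (Fin k₂ × Fin ℓ) → V := Sum.elim
    (fun a => if φ (Sum.inl (a, 0)) ∈ A then φ (Sum.inl (a, 0))
      else φ (Sum.inl (a, ⟨1, by omega⟩)))
    (fun x => if φ (Sum.inr (x.1, ⟨2 * x.2, by omega⟩)) ∈ A
      then φ (Sum.inr (x.1, ⟨2 * x.2, by omega⟩))
      else φ (Sum.inr (x.1, ⟨2 * x.2 + 1, by omega⟩))) with hg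
  have hgA : ∀ x, g x ∈ A := by
    rintro (a | x)
    · simp only [hg, Sum.elim_inl]
      split_ifs with h
      · exact h
      · exact (hA (hstar a)).resolve_left h
    · simp only [hg, Sum.elim_inr]
      split_ifs with h
      · exact h
      · exact (hA (hpath x)).resolve_left h
  have hginj : Function.Injective g := by
    rintro (a | x) (b | y) h
    · simp only [hg, Sum.elim_inl] at h
      split_ifs at h <;> simpa using hφ h
    · simp only [hg, Sum.elim_inl, Sum.elim_inr] at h
      split_ifs at h <;> simpa using hφ h
    · simp only [hg, Sum.elim_inl, Sum.elim_inr] at h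
      split_ifs at h <;> simpa using hφ h
    · simp only [hg, Sum.elim_inr] at h
      have : x.1 = y.1 ∧ (x.2 : ℕ) = y.2 := by
        split_ifs at h <;> (have h' := hφ h; simp at h'; exact ⟨h'.1, by omega⟩)
      rw [Prod.ext this.1 (Fin.ext this.2)]
  have h1 := Finset.card_le_card_of_injOn g (s := Finset.univ) (t := A) (fun x _ => hgA x)
    hginj.injOn
  simp only [Finset.card_univ, Fintype.card_sum, Fintype.card_prod, Fintype.card_fin] at h1
  rw [mul_comm k₂ ℓ] at h1
  omega

variable [Fintype V]

/-- Stars can be added to a linear forest greedily, at centres of large degree. -/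
theorem starPathForest_isContained {w : ℕ → V} (hw : IsPathForestSeq G (2 * ℓ) k₂ w) (hℓ : 1 ≤ ℓ)
    {C : Finset V} (hC : C.card = k₁) (hwC : ∀ i, i < 2 * ℓ * k₂ → w i ∉ C)
    (hdeg : ∀ c ∈ C, 2 * ℓ * (k₁ + k₂) ≤ G.degree c + 1) :
    (starPathForest k₁ k₂ ℓ).IsContained G := by
  set e : Fin k₁ ≃ C := (Finset.equivFinOfCardEq hC).symm
  set U : Finset V := (Finset.range (2 * ℓ * k₂)).image w with hU
  have hUcard : U.card ≤ 2 * ℓ * k₂ := Finset.card_image_le.trans (by simp)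
  -- Hall's condition for the choice of the leaves holds because each set of candidates is large
  obtain ⟨f, hf, hfmem⟩ := (Finset.all_card_le_biUnion_card_iff_exists_injective
    (fun x : Fin k₁ × Fin (2 * ℓ - 1) => G.neighborFinset (e x.1 : V) \ (U ∪ C))).mp (by
      intro s
      rcases s.eq_empty_or_nonempty with rfl | ⟨x, hx⟩
      · simp
      have h1 : s.card ≤ k₁ * (2 * ℓ - 1) := by
        refine (Finset.card_le_univ s).trans ?_
        simp
      refine le_trans ?_ (Finset.card_le_card (Finset.subset_biUnion_of_mem
        (fun x : Fin k₁ × Fin (2 * ℓ - 1) => G.neighborFinset (e x.1 : V) \ (U ∪ C)) hx))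
      set c : V := (e x.1 : V) with hc
      have hcC : c ∈ C := (e x.1).2
      have hsub : G.neighborFinset c \ (U ∪ C.erase c) ⊆ G.neighborFinset c \ (U ∪ C) := by
        intro y hy
        simp only [Finset.mem_sdiff, Finset.mem_union, Finset.mem_erase, not_or, not_and,
          SimpleGraph.mem_neighborFinset] at hy ⊢
        exact ⟨hy.1, hy.2.1, hy.2.2 hy.1.ne'⟩
      refine le_trans ?_ (Finset.card_le_card hsub)
      have h2 := Finset.le_card_sdiff (U ∪ C.erase c) (G.neighborFinset c)
      have h3 := Finset.card_union_le U (C.erase c)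
      rw [Finset.card_erase_of_mem hcC, hC] at h3
      rw [SimpleGraph.card_neighborFinset_eq_degree] at h2
      have h4 := hdeg c hcC
      have h5 : 0 < k₁ := by rw [← hC]; exact Finset.card_pos.mpr ⟨c, hcC⟩
      have h6 : k₁ * (2 * ℓ - 1) + k₁ = 2 * ℓ * k₁ := by
        obtain ⟨j, rfl⟩ : ∃ j, ℓ = j + 1 := ⟨ℓ - 1, by omega⟩
        have : 2 * (j + 1) - 1 = 2 * j + 1 := by omega
        rw [this]; ring
      have h7 : 2 * ℓ * (k₁ + k₂) = 2 * ℓ * k₁ + 2 * ℓ * k₂ := by ring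
      omega)
  have hfadj : ∀ x, G.Adj (e x.1) (f x) := fun x => by
    have := hfmem x
    simp only [Finset.mem_sdiff, SimpleGraph.mem_neighborFinset] at this
    exact this.1
  have hfU : ∀ x, f x ∉ U := fun x => by
    have := hfmem x
    simp only [Finset.mem_sdiff, Finset.mem_union, not_or] at this
    exact this.2.1
  have hfC : ∀ x, f x ∉ C := fun x => by
    have := hfmem x
    simp only [Finset.mem_sdiff, Finset.mem_union, not_or] at this
    exact this.2.2
  have hidx : ∀ x : Fin k₂ × Fin (2 * ℓ), 2 * ℓ * x.1 + x.2 < 2 * ℓ * k₂ := by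
    rintro ⟨⟨a, ha⟩, ⟨i, hi⟩⟩
    calc 2 * ℓ * a + i < 2 * ℓ * a + 2 * ℓ := by omega
      _ = 2 * ℓ * (a + 1) := by ring
      _ ≤ 2 * ℓ * k₂ := Nat.mul_le_mul_left _ ha
  have hwU : ∀ x : Fin k₂ × Fin (2 * ℓ), w (2 * ℓ * x.1 + x.2) ∈ U := fun x =>
    Finset.mem_image.mpr ⟨_, Finset.mem_range.mpr (hidx x), rfl⟩
  set star : Fin k₁ × Fin (2 * ℓ - 1 + 1) → V :=
    fun x => Fin.cases (motive := fun _ => V) (e x.1 : V) (fun j => f (x.1, j)) x.2 with hstar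
  have hstar0 : ∀ a, star (a, 0) = e a := fun a => rfl
  have hstarS : ∀ a j, star (a, Fin.succ j) = f (a, j) := fun a j => rfl
  set path : Fin k₂ × Fin (2 * ℓ) → V := fun x => w (2 * ℓ * x.1 + x.2) with hpath
  have hsp : ∀ x y, star x ≠ path y := by
    rintro ⟨a, j⟩ y h
    induction j using Fin.cases with
    | zero =>
      rw [hstar0] at h
      refine hwC _ (hidx y) ?_
      rw [show w (2 * ℓ * y.1 + y.2) = e a from h.symm]
      exact (e a).2
    | succ j =>
      rw [hstarS] at h
      exact hfU (a, j) (h ▸ hwU y)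
  have hstarinj : Function.Injective star := by
    rintro ⟨a, j⟩ ⟨a', j'⟩ h
    induction j using Fin.cases with
    | zero =>
      induction j' using Fin.cases with
      | zero =>
        rw [hstar0, hstar0] at h
        rw [e.injective (Subtype.ext h)]
      | succ j' =>
        rw [hstar0, hstarS] at h
        exact absurd (h ▸ (e a).2) (hfC (a', j'))
    | succ j =>
      induction j' using Fin.cases with
      | zero =>
        rw [hstar0, hstarS] at h
        exact absurd (h ▸ (e a').2) (hfC (a, j))
      | succ j' =>
        rw [hstarS, hstarS] at h
        have := hf h
        simp only [Prod.mk.injEq] at this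
        rw [this.1, this.2]
  have hpathinj : Function.Injective path := by
    intro x y h
    have h1 := hw.inj (hidx x) (hidx y) h
    have h2 : (x.1 : ℕ) = y.1 := by
      have hx := Nat.mul_add_div (show 2 * ℓ > 0 by omega) x.1 x.2
      have hy := Nat.mul_add_div (show 2 * ℓ > 0 by omega) y.1 y.2
      rw [Nat.div_eq_of_lt x.2.2] at hx
      rw [Nat.div_eq_of_lt y.2.2] at hy
      rw [h1] at hx
      omega
    rw [h2] at h1
    exact Prod.ext (Fin.ext h2) (Fin.ext (by omega))
  have hpathadj : ∀ (a : Fin k₂) (i j : Fin (2 * ℓ)), (i : ℕ) + 1 = j →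
      G.Adj (path (a, i)) (path (a, j)) := by
    intro a i j hij
    have h1 := hidx (a, j)
    simp only [hpath]
    simp only at h1
    rw [← hij, ← add_assoc] at h1 ⊢
    refine hw.adj h1 ?_
    rw [add_assoc, Nat.dvd_add_right (Dvd.intro _ rfl)]
    intro hd
    have := Nat.le_of_dvd (by omega) hd
    have := j.2
    omega
  refine ⟨⟨⟨Sum.elim star path, ?_⟩, ?_⟩⟩
  · rintro (⟨a, j⟩ | ⟨a, i⟩) (⟨a', j'⟩ | ⟨a', i'⟩) h
    · obtain ⟨h1, h2⟩ : a = a' ∧ (starS (2 * ℓ - 1)).Adj j j' := by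
        simpa [starPathForest, copies] using h
      subst h1
      rw [starS, SimpleGraph.starGraph_adj] at h2
      obtain ⟨hne, rfl | rfl⟩ := h2
      · induction j' using Fin.cases with
        | zero => exact absurd rfl hne
        | succ j' => exact hfadj (a, j')
      · induction j using Fin.cases with
        | zero => exact absurd rfl hne
        | succ j => exact (hfadj (a, j)).symm
    · simp [starPathForest] at h
    · simp [starPathForest] at h
    · obtain ⟨h1, h2⟩ : a = a' ∧ (SimpleGraph.pathGraph (2 * ℓ)).Adj i i' := by
        simpa [starPathForest, copies] using h
      subst h1
      rcases SimpleGraph.pathGraph_adj.mp h2 with h3 | h3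
      · exact hpathadj a i i' h3
      · exact (hpathadj a i' i h3).symm
  · exact hstarinj.sumElim hpathinj hsp

/-- Large linear forests in graphs of large minimum degree: with two vertices of large degree, either
there are `k₂` disjoint paths on `2ℓ` vertices, or there is a vertex cover of size `ℓ k₂ - 1`. -/
theorem exists_pathForest_or_isCover (hk : 2 ≤ k₂) (hℓ : 1 ≤ ℓ)
    (hr : ∀ x, ℓ * k₂ - 1 ≤ G.degree x) {b b' : V} (hbb : b ≠ b')
    (hb : 2 * (ℓ * k₂ - 1) < G.degree b) (hb' : 2 * (ℓ * k₂ - 1) < G.degree b') :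
    (∃ w, IsPathForestSeq G (2 * ℓ) k₂ w) ∨ ∃ A : Finset V, A.card = ℓ * k₂ - 1 ∧ IsCover G A := by
  have hN : 2 * ℓ * k₂ = 2 * (ℓ * k₂) := mul_assoc _ _ _
  have hN2 : ℓ * 2 ≤ ℓ * k₂ := Nat.mul_le_mul_left ℓ hk
  by_cases hpath : ∀ a c s, PathOn G a c s → s.card < 2 * (ℓ * k₂ - 1) + 2
  · by_cases hG : G.Preconnected
    · exact Or.inr (exists_isCover_of_connected hG hr hbb hb hb' hpath)
    -- all but one of the paths are found in the component of `b`, the last one elsewhere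
    · left
      obtain ⟨z, hz⟩ : ∃ z, ¬ G.Reachable b z := by
        by_contra! hcon
        exact hG fun x y => (hcon x).symm.trans (hcon y)
      obtain ⟨p, v, h, hbv⟩ := exists_isLongestPath G b
      have hp := h.two_mul_le_of_degree hr hbv hb
      obtain ⟨c, s, hs, hsc⟩ := exists_pathOn_of_degree hr z (k := 2 * ℓ - 1) (by omega)
      obtain ⟨p', v', h', h0, -, -, hc⟩ := hs.exists_seq
      have hdisj : ∀ i j, i ≤ p → j ≤ p' → v i ≠ v' j := by
        intro i j hi hj heq
        have h1 := (h.pathOn (Nat.zero_le p) le_rfl).reachable (mem_seg_self le_rfl (Nat.zero_le p))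
          (mem_seg_self (Nat.zero_le i) hi)
        have h2 := (h'.pathOn (Nat.zero_le p') le_rfl).reachable
          (mem_seg_self (Nat.zero_le j) hj) (mem_seg_self le_rfl (Nat.zero_le p'))
        rw [h0] at h2
        rw [← heq] at h2
        exact hz (hbv.trans (h1.trans h2))
      set M := 2 * ℓ * (k₂ - 1) with hM
      have hMk : 2 * ℓ * k₂ = M + 2 * ℓ := by
        obtain ⟨j, rfl⟩ : ∃ j, k₂ = j + 1 := ⟨k₂ - 1, by omega⟩
        rw [hM, Nat.add_sub_cancel]; ring
      refine ⟨fun i => if i < M then v i else v' (i - M), fun i j hi hj hij => ?_,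
        fun i hi hdvd => ?_⟩
      · split_ifs at hij with h1 h2 h2
        · exact h.inj (by omega) (by omega) hij
        · exact absurd hij (hdisj _ _ (by omega) (by omega))
        · exact absurd hij.symm (hdisj _ _ (by omega) (by omega))
        · have := h'.inj (by omega) (by omega) hij
          omega
      · have hiM : i + 1 ≠ M := by
          rintro hiM
          exact hdvd (hiM ▸ Dvd.intro _ rfl)
        by_cases h1 : i < M
        · rw [if_pos h1, if_pos (by omega)]
          exact h.adj (by omega)
        · rw [if_neg h1, if_neg (by omega), show i + 1 - M = i - M + 1 by omega]
          exact h'.adj (by omega)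
  · push Not at hpath
    obtain ⟨a, c, s, hs, hsc⟩ := hpath
    obtain ⟨p, v, hv, -, -, -, hc⟩ := hs.exists_seq
    exact Or.inl ⟨v, fun i j hi hj hij => hv.inj (by omega) (by omega) hij,
      fun i hi _ => hv.adj (by omega)⟩

lemma degree_sub_card_le_degree_induce (G : SimpleGraph V) (C : Finset V)
    (x : {x | x ∉ C}) [Fintype ((G.induce {x | x ∉ C}).neighborSet x)] :
    G.degree x - C.card ≤ (G.induce {x | x ∉ C}).degree x := by
  rw [← SimpleGraph.card_neighborFinset_eq_degree, ← SimpleGraph.card_neighborFinset_eq_degree,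
    Nat.sub_le_iff_le_add]
  refine le_trans (Finset.card_le_card (t := ((G.induce {x | x ∉ C}).neighborFinset x).image
    Subtype.val ∪ C) fun y hy => ?_) ((Finset.card_union_le _ _).trans
      (Nat.add_le_add_right Finset.card_image_le _))
  rw [SimpleGraph.mem_neighborFinset] at hy
  by_cases hyC : y ∈ C
  · exact Finset.mem_union_right _ hyC
  · exact Finset.mem_union_left _ (Finset.mem_image.mpr ⟨⟨y, hyC⟩, by simpa using hy, rfl⟩)

/-- A forest-free graph of minimum degree at least `h = k₁ + ℓ k₂ - 1` with enough vertices of large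
degree has a vertex cover of size `h`: `k₁` of these vertices can serve as star centres, so that the
graph without them has no `k₂` disjoint paths. -/
theorem exists_isCover_of_free (hk : 2 ≤ k₂) (hℓ : 1 ≤ ℓ)
    (hfree : (starPathForest k₁ k₂ ℓ).Free G) (hδ : ∀ x, k₁ + ℓ * k₂ - 1 ≤ G.degree x)
    {L : Finset V} (hL : k₁ + 2 ≤ L.card)
    (hdeg : ∀ c ∈ L, 2 * ℓ * (k₁ + k₂) ≤ G.degree c + 1) :
    ∃ A : Finset V, A.card = k₁ + ℓ * k₂ - 1 ∧ IsCover G A := by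
  have hN2 : ℓ * 2 ≤ ℓ * k₂ := Nat.mul_le_mul_left ℓ hk
  have hk1 : 1 * k₁ ≤ ℓ * k₁ := Nat.mul_le_mul_right k₁ hℓ
  have hf : 2 * ℓ * (k₁ + k₂) = 2 * (ℓ * k₁) + 2 * (ℓ * k₂) := by ring
  obtain ⟨C, hCL, hC⟩ := Finset.exists_subset_card_eq (show k₁ ≤ L.card by omega)
  have hLC : 1 < (L \ C).card := by
    have := Finset.le_card_sdiff C L
    omega
  obtain ⟨b, hb, b', hb', hbb⟩ := Finset.one_lt_card.mp hLC
  rw [Finset.mem_sdiff] at hb hb'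
  have hbdeg : ∀ x ∈ L, 2 * (ℓ * k₂ - 1) < G.degree x - C.card := by
    intro x hx
    have h1 := hdeg x hx
    omega
  rcases exists_pathForest_or_isCover (G := G.induce {x | x ∉ C}) (b := ⟨b, hb.2⟩)
    (b' := ⟨b', hb'.2⟩) hk hℓ
    (fun x => le_trans (by have h1 := hδ x; omega) (@degree_sub_card_le_degree_induce _ _ G C x _))
    (by simpa using hbb)
    ((hbdeg b hb.1).trans_le (@degree_sub_card_le_degree_induce _ _ G C ⟨b, hb.2⟩ _))
    ((hbdeg b' hb'.1).trans_le (@degree_sub_card_le_degree_induce _ _ G C ⟨b', hb'.2⟩ _)) with ⟨w, hw⟩ | ⟨A, hA, hAc⟩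
  · refine absurd (starPathForest_isContained (w := fun i => (w i : V)) ⟨fun i j hi hj hij => ?_,
      fun i hi hd => ?_⟩ hℓ hC (fun i _ => (w i).2) fun c hc => hdeg c (hCL hc)) hfree
    · exact hw.inj hi hj (Subtype.ext hij)
    · exact hw.adj hi hd
  · refine ⟨A.map (Function.Embedding.subtype _) ∪ C, ?_, fun x y hxy => ?_⟩
    · rw [Finset.card_union_of_disjoint, Finset.card_map, hA, hC]
      · omega
      · rw [Finset.disjoint_left]
        intro x hx hxC
        obtain ⟨y, -, rfl⟩ := Finset.mem_map.mp hx
        exact y.2 hxC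
    · by_cases hxC : x ∈ C
      · exact Or.inl (Finset.mem_union_right _ hxC)
      by_cases hyC : y ∈ C
      · exact Or.inr (Finset.mem_union_right _ hyC)
      refine (hAc (u := ⟨x, hxC⟩) (v := ⟨y, hyC⟩) (by simpa using hxy)).imp (fun h => ?_) fun h => ?_
      · exact Finset.mem_union_left _ (Finset.mem_map.mpr ⟨_, h, rfl⟩)
      · exact Finset.mem_union_left _ (Finset.mem_map.mpr ⟨_, h, rfl⟩)

end Forest

/-! ### Extremal graphs -/

section Parameters

/-- The bounds on the order `2 ℓ (k₁ + k₂)` of the forest in terms of `h = k₁ + ℓ k₂ - 1`. -/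
lemma parameter_bounds {k₁ k₂ ℓ h : ℕ} (hk₁ : 1 ≤ k₁) (hk₂ : 2 ≤ k₂) (hℓ : 2 ≤ ℓ)
    (hh : h = k₁ + ℓ * k₂ - 1) :
    4 ≤ h ∧ k₁ + 2 ≤ h ∧ h ≤ 2 ^ (h - 2) ∧ 2 * h + 4 ≤ 2 * ℓ * (k₁ + k₂) ∧
      2 * ℓ * (k₁ + k₂) ≤ 3 * 2 ^ (h - 2) := by
  have h1 : ℓ * 2 ≤ ℓ * k₂ := Nat.mul_le_mul_left ℓ hk₂
  have h4 : 4 ≤ h := by omega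
  have hpow : ∀ j : ℕ, j + 4 ≤ 2 ^ (j + 2) ∧ (j + 7) ^ 2 ≤ 12 * 2 ^ (j + 2) + 1 := by
    intro j
    induction j with
    | zero => norm_num
    | succ j ih =>
      obtain ⟨i1, i2⟩ := ih
      rw [show j + 1 + 2 = (j + 2) + 1 by ring, pow_succ]
      constructor
      · omega
      · nlinarith
  obtain ⟨p1, p2⟩ := hpow (h - 4)
  rw [show h - 4 + 4 = h by omega, show h - 4 + 2 = h - 2 by omega] at p1
  rw [show h - 4 + 7 = h + 3 by omega, show h - 4 + 2 = h - 2 by omega] at p2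
  obtain ⟨a, rfl⟩ : ∃ a, ℓ = a + 1 := ⟨ℓ - 1, by omega⟩
  have hf : 2 * (a + 1) * (k₁ + k₂) = 2 * (a * k₁) + 2 * (h + 1) := by
    have : h + 1 = k₁ + (a + 1) * k₂ := by omega
    rw [this]; ring
  have hak : 1 * 1 ≤ a * k₁ := Nat.mul_le_mul (by omega) hk₁
  refine ⟨h4, by omega, p1, by omega, ?_⟩
  -- `2a + k₁ ≤ h - 1`, and a product is at most a quarter of the square of the sum
  have hsum : 2 * a + k₁ + 1 ≤ h := by omega
  have hprod : 8 * (a * k₁) + 8 * (h + 1) ≤ (h + 3) ^ 2 := by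
    zify at hsum ⊢
    nlinarith [sq_nonneg ((2 * a : ℤ) - k₁), mul_nonneg (show (0 : ℤ) ≤ h - 1 - (2 * a + k₁) by
      linarith) (show (0 : ℤ) ≤ h - 1 + (2 * a + k₁) by omega)]
  omega

end Parameters

section Deletion

/-- The real inequality behind the deletion step. Here `q = h - 1`, `m = t²` is the number of
vertices before the deletion, `t'` the square root of the number of vertices after it, `N = √n`, and
`ρ`, `ρ'` are the spectral radii before and after the deletion of a vertex whose squared entry in the
Perron vector is `s`. -/
lemma deletion_inequality {h q m t t' N ρ ρ' s : ℝ} (hq : q = h - 1) (hh : 4 ≤ h)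
    (hm : h + 1 ≤ m) (ht : 0 < t) (htm : t ^ 2 = m) (ht' : 0 ≤ t') (htm' : t' ^ 2 = m - 1)
    (hN : 2 * h ^ 2 ≤ N) (hρ : q < ρ) (hs0 : 0 ≤ s) (hsm : s * m ≤ 1)
    (h1 : ρ ^ 2 * s ≤ q * (1 - (m - q) * s)) (h2 : ρ * (1 - 2 * s) ≤ ρ' * (1 - s))
    (hbound : q * m + N * t - h ^ 2 ≤ ρ * (ρ - q)) :
    q * (m - 1) + N * t' - h ^ 2 ≤ ρ' * (ρ' - q) := by
  have hq3 : 3 ≤ q := by linarith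
  have hρ0 : 0 < ρ := by linarith
  have hN0 : 0 < N := by nlinarith
  have hs1 : s < 1 := by nlinarith
  set K := q * (m - h) with hK
  have hKq : q ≤ K := by nlinarith
  have hpos : 0 < ρ ^ 2 + K := by linarith [sq_nonneg ρ]
  set Δ := ρ * q / (ρ ^ 2 + K) with hΔ
  have hΔeq : Δ * (ρ ^ 2 + K) = ρ * q := div_mul_cancel₀ _ hpos.ne'
  have hΔ0 : 0 ≤ Δ := by positivity
  have h3 : s * (ρ ^ 2 + K) ≤ q * (1 - s) := by
    rw [hK, show h = q + 1 by linarith]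
    linarith
  -- the spectral radius drops by at most `Δ`
  have h4 : ρ - Δ ≤ ρ' := by
    have h5 : ρ * s ≤ Δ * (1 - s) := by
      rw [← mul_le_mul_iff_left₀ hpos]
      calc ρ * s * (ρ ^ 2 + K) = ρ * (s * (ρ ^ 2 + K)) := by ring
        _ ≤ ρ * (q * (1 - s)) := mul_le_mul_of_nonneg_left h3 hρ0.le
        _ = Δ * (ρ ^ 2 + K) * (1 - s) := by rw [hΔeq]; ring
        _ = _ := by ring
    have h6 : (ρ - Δ) * (1 - s) ≤ ρ' * (1 - s) := by linarith
    exact le_of_mul_le_mul_right h6 (by linarith)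
  have hΔ1 : Δ ≤ 1 := by
    rw [hΔ, div_le_one hpos]
    nlinarith
  have h7 : (ρ - Δ) * (ρ - Δ - q) ≤ ρ' * (ρ' - q) := by
    have := mul_nonneg (show 0 ≤ ρ' - (ρ - Δ) by linarith)
      (show 0 ≤ ρ' + (ρ - Δ) - q by linarith)
    linarith
  -- `c` bounds the drop of the term `N √m`
  set c := N / (2 * t) with hc
  have hct : c * t = N / 2 := by rw [hc]; field_simp
  have hc0 : 0 < c := by positivity
  have htt : t' ≤ t := (pow_le_pow_iff_left₀ ht' ht.le two_ne_zero).mp (by linarith)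
  have h8 : c ≤ N * (t - t') := by
    have : (t - t') * (t + t') = 1 := by linarith
    have h9 : 1 ≤ (t - t') * (2 * t) := by linarith [sq_nonneg (t - t')]
    rw [hc, div_le_iff₀ (by positivity)]
    linarith [mul_le_mul_of_nonneg_left h9 hN0.le]
  set E := ρ * (ρ - q) - (q * m + N * t - h ^ 2) with hE
  have hE0 : 0 ≤ E := by linarith
  have ht1 : 1 ≤ t := by nlinarith
  have h10 : ρ * q * (2 * ρ - q) ≤ (E + q + c) * (ρ ^ 2 + K) := by
    have e1 : 0 ≤ E * (ρ ^ 2 + K - q) := mul_nonneg hE0 (by linarith [sq_nonneg ρ])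
    have e2 : 2 * q * m + N * t - h ^ 2 - q * h ≤ ρ ^ 2 + K := by
      rw [hK]; linarith [mul_pos (show 0 < q by linarith) hρ0]
    have e3 : 0 ≤ c * (N * t - h ^ 2 - q * h) := by
      refine mul_nonneg hc0.le ?_
      have : N ≤ N * t := le_mul_of_one_le_right hN0.le ht1
      have : q * h ≤ h ^ 2 := by rw [hq]; linarith
      linarith
    have e4 : c * (2 * q * m) = q * (N * t) := by
      rw [← htm]; linear_combination 2 * q * t * hct
    have e5 := mul_le_mul_of_nonneg_left e2 hc0.le
    have e6 : ρ * q * (2 * ρ - q) = q * (ρ ^ 2) + q * (q * m + N * t - h ^ 2 + E) := by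
      rw [hE]; ring
    have e7 : q * K = q * (q * m) - q * (q * h) := by rw [hK]; ring
    have e8 : q * (q * h) = q * h ^ 2 - q * h := by rw [hq]; ring
    have e9 : 0 ≤ q * h := mul_nonneg (by linarith) (by linarith)
    linarith
  have h11 : Δ * (2 * ρ - q) ≤ E + q + c := by
    rw [← mul_le_mul_iff_left₀ hpos]
    calc Δ * (2 * ρ - q) * (ρ ^ 2 + K) = ρ * q * (2 * ρ - q) := by rw [← hΔeq]; ring
      _ ≤ _ := h10
  linarith [sq_nonneg Δ]

end Deletion

section Main

open scoped Classical

variable {k₁ k₂ ℓ n h : ℕ}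

/-- A forest-free graph on `m ≤ n` vertices whose spectral radius satisfies
`ρ (ρ - (h - 1)) ≥ (h - 1) m + √(n m) - h²`, where `h = k₁ + ℓ k₂ - 1`, has `m = n` and a vertex cover
of size `h`. The bound is chosen so that it is inherited when a suitable vertex is deleted from a
graph with a vertex of degree less than `h`; it exceeds the spectral bound for graphs with a
vertex cover of size `h` unless `m = n`. -/
theorem eq_and_exists_isCover (hk₁ : 1 ≤ k₁) (hk₂ : 2 ≤ k₂) (hℓ : 2 ≤ ℓ)
    (hh : h = k₁ + ℓ * k₂ - 1) (hn : 2 ^ (4 * h) ≤ n) (m : ℕ) (hm1 : 1 ≤ m) (hmn : m ≤ n)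
    {V : Type*} [Fintype V] (hV : Fintype.card V = m) (G : SimpleGraph V)
    (hfree : (starPathForest k₁ k₂ ℓ).Free G)
    (hbound : ((h : ℝ) - 1) * m + √n * √m - (h : ℝ) ^ 2 ≤
      adjSpectralRadius G * (adjSpectralRadius G - (h - 1))) :
    m = n ∧ ∃ A : Finset V, A.card = h ∧ IsCover G A := by
  obtain ⟨b4, bk, bX, bf, bfX⟩ := parameter_bounds hk₁ hk₂ hℓ hh
  set f := 2 * ℓ * (k₁ + k₂) with hf
  have b4' : (4 : ℝ) ≤ h := by exact_mod_cast b4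
  set X : ℝ := 2 ^ (h - 2) with hX
  have bX' : (h : ℝ) ≤ X := by rw [hX]; exact_mod_cast bX
  have bf' : 2 * (h : ℝ) + 4 ≤ f := by exact_mod_cast bf
  have bfX' : (f : ℝ) ≤ 3 * X := by rw [hX]; exact_mod_cast bfX
  have hN : 16 * X ^ 2 ≤ √n := by
    apply Real.le_sqrt_of_sq_le
    have : ((2 : ℝ) ^ (4 * h)) ≤ n := by exact_mod_cast hn
    refine le_of_eq_of_le ?_ this
    rw [hX, ← pow_mul, show (16 : ℝ) = 2 ^ 4 by norm_num, ← pow_add, ← pow_mul]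
    congr 1
    omega
  clear_value X
  have hN2 : 2 * (h : ℝ) ^ 2 ≤ √n := by nlinarith
  induction m generalizing V with
  | zero => omega
  | succ m ih =>
    set M : ℝ := ((m + 1 : ℕ) : ℝ) with hM
    have : Nonempty V := Fintype.card_pos_iff.mp (by omega)
    set ρ := adjSpectralRadius G with hρdef
    have hρ0 : 0 ≤ ρ := adjSpectralRadius_nonneg G
    have hM1 : 1 ≤ M := by rw [hM]; exact_mod_cast hm1
    have ht1 : 1 ≤ √M := Real.one_le_sqrt.mpr hM1
    have htM : √M ^ 2 = M := Real.sq_sqrt (by linarith)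
    have hNt : √n ≤ √n * √M := le_mul_of_one_le_right (Real.sqrt_nonneg _) ht1
    have hρq : (h : ℝ) - 1 < ρ := by nlinarith
    by_cases hδ : ∃ u, G.degree u ≤ h - 1
    · exfalso
      obtain ⟨u, hu⟩ := hδ
      -- some degree exceeds `h - 1`, as `ρ` does
      obtain ⟨z, hz⟩ : ∃ z, h - 1 < G.degree z := by
        by_contra! hcon
        have h1 := adjSpectralRadius_le_sqrt_add G ∅ 0 ((h : ℝ) - 1) (by simp)
          (by push_cast; linarith) (fun v _ => by
            have : (G.degree v : ℝ) ≤ ((h - 1 : ℕ) : ℝ) := by exact_mod_cast hcon v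
            rwa [Nat.cast_sub (by omega), Nat.cast_one] at this)
        simp only [Nat.cast_zero, zero_mul, Real.sqrt_zero, zero_add] at h1
        linarith
      have hmh : h + 1 ≤ m + 1 := by
        have := G.degree_lt_card_verts z
        omega
      have : Nontrivial V := Fintype.one_lt_card_iff_nontrivial.mp (by omega)
      have hu' : (G.degree u : ℝ) ≤ (h : ℝ) - 1 := by
        have : (G.degree u : ℝ) ≤ ((h - 1 : ℕ) : ℝ) := by exact_mod_cast hu
        rwa [Nat.cast_sub (by omega), Nat.cast_one] at this
      obtain ⟨w, s, hs0, hsm, hs1, hs2⟩ := exists_vertex_deletion G ((h : ℝ) - 1) u hu'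
      rw [hV] at hsm hs1
      have hMm : (m : ℝ) = M - 1 := by rw [hM]; push_cast; ring
      have key := deletion_inequality (t' := √(m : ℝ)) rfl b4'
        (by rw [hM]; exact_mod_cast hmh) (by linarith) htM (Real.sqrt_nonneg _)
        (by rw [Real.sq_sqrt (Nat.cast_nonneg m), hMm]) hN2 hρq hs0 hsm hs1 hs2 hbound
      have hcard : Fintype.card {v | v ≠ w} = m := by
        rw [Set.card_ne_eq, hV]; rfl
      have := (ih (by omega) (by omega) hcard (G.induce {v | v ≠ w})
        (fun hc => hfree (hc.trans ⟨SimpleGraph.Copy.induce G _⟩)) (by rwa [← hMm] at key)).1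
      omega
    · push Not at hδ
      set L : Finset V := Finset.univ.filter fun v => f ≤ G.degree v + 1 with hL
      have hLcard : h ≤ L.card := by
        -- otherwise the edges at the vertices of large degree do not account for `ρ`
        by_contra! hcon
        have h1 := adjSpectralRadius_le_sqrt_add G L (h - 1) ((f : ℝ) - 2) (by omega)
          (by rw [Nat.cast_sub (by omega)]; push_cast; linarith) (fun v hv => by
            have : ¬ f ≤ G.degree v + 1 := fun h => hv (by simpa [hL] using h)
            have : (G.degree v : ℝ) + 2 ≤ f := by exact_mod_cast (by omega : G.degree v + 2 ≤ f)
            linarith)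
        rw [hV, Nat.cast_sub (by omega), Nat.cast_one, Real.sqrt_mul (by linarith)] at h1
        set y := √((h : ℝ) - 1) with hy
        have hy2 : y ^ 2 = h - 1 := Real.sq_sqrt (by linarith)
        have hy0 : 0 ≤ y := Real.sqrt_nonneg _
        have hyh : y ≤ h := Real.sqrt_le_iff.mpr ⟨by linarith, by nlinarith⟩
        set D : ℝ := (f : ℝ) - 2 with hD
        have hys : 0 ≤ y * √M := by positivity
        have h2 : ρ * (ρ - (h - 1)) ≤ (y * √M + D) * (y * √M + D - (h - 1)) :=
          mul_le_mul h1 (by linarith) (by linarith) (by linarith)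
        have h3 : (y * √M) ^ 2 = (h - 1) * M := by rw [mul_pow, hy2, htM]
        have h4 : (h : ℝ) ^ 2 ≤ D * (h - 1) := by
          linarith [mul_nonneg (show 0 ≤ D - (2 * h + 2) by linarith)
            (show 0 ≤ (h : ℝ) - 1 by linarith), mul_nonneg (show 0 ≤ (h : ℝ) - 4 by linarith)
            (show 0 ≤ (h : ℝ) by linarith)]
        have h5 : 2 * (h * D) + D ^ 2 < √n := by
          have i1 : h * D ≤ X * (3 * X) :=
            mul_le_mul bX' (by linarith) (by linarith) (by linarith)
          have i2 : D ^ 2 ≤ (3 * X) ^ 2 := pow_le_pow_left₀ (by linarith) (by linarith) 2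
          have i3 : 0 < X ^ 2 := pow_pos (by linarith) 2
          linarith
        have h6 : y * √M * (2 * D) ≤ h * √M * (2 * D) := by gcongr; linarith
        have h7 : D ^ 2 ≤ D ^ 2 * √M := le_mul_of_one_le_right (sq_nonneg _) ht1
        have h8 : (2 * (h * D) + D ^ 2) * √M < √n * √M :=
          mul_lt_mul_of_pos_right h5 (by linarith)
        have h9 : 0 ≤ y * √M * (h - 1) := mul_nonneg hys (by linarith)
        linarith
      obtain ⟨A, hA, hAc⟩ := exists_isCover_of_free hk₂ (by omega) hfree
        (fun x => by have := hδ x; omega) (L := L) (by omega)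
        (fun c hc => (Finset.mem_filter.mp hc).2)
      rw [← hh] at hA
      refine ⟨?_, A, hA, hAc⟩
      have h1 := (hAc.adjSpectralRadius_bound (by linarith) (by omega)).1
      rw [hA, hV] at h1
      have h2 : √n * √M ≤ M := by linarith
      have h3 : √n ≤ √M := by nlinarith
      have h4 : (n : ℝ) ≤ M := (Real.sqrt_le_sqrt_iff (by linarith)).mp h3
      have h5 : n ≤ m + 1 := by rw [hM] at h4; exact_mod_cast h4
      omega

/-- A graph with a vertex cover `A` of size `h` all of whose vertices are adjacent to all other
vertices is `S_{n,h}`. -/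
lemma nonempty_iso_completeSplit {V : Type*} [Fintype V] (hV : Fintype.card V = n)
    {G : SimpleGraph V} {A : Finset V} (hA : A.card = h) (hAc : IsCover G A)
    (hfull : ∀ u ∈ A, ∀ v, u ≠ v → G.Adj u v) : Nonempty (G ≃g completeSplit n h) := by
  have e₁ : Fin h ≃ {v // v ∈ A} := (Finset.equivFinOfCardEq hA).symm
  have e₂ : Fin (n - h) ≃ {v // v ∉ A} := (Fintype.equivFinOfCardEq (by
    rw [Fintype.card_subtype_compl, hV, Fintype.card_coe, hA])).symm
  set e : Fin h ⊕ Fin (n - h) ≃ V := (e₁.sumCongr e₂).trans (Equiv.sumCompl _) with he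
  have hl : ∀ i, e (Sum.inl i) ∈ A := fun i => by simp [he]
  have hr : ∀ i, e (Sum.inr i) ∉ A := fun i => by simpa [he] using (e₂ i).2
  refine ⟨SimpleGraph.Iso.symm ⟨e, fun {x y} => ?_⟩⟩
  rcases x with i | i <;> rcases y with j | j
  · have : G.Adj (e (Sum.inl i)) (e (Sum.inl j)) ↔ i ≠ j :=
      ⟨fun h hij => h.ne (by rw [hij]), fun h => hfull _ (hl i) _ fun h' => h (by simpa using h')⟩
    simpa [completeSplit, join] using this
  · simpa [completeSplit, join] using hfull _ (hl i) _ fun h' => by simpa using e.injective h'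
  · simpa [completeSplit, join] using
      (hfull _ (hl j) (e (Sum.inr i)) fun h' => by simpa using e.injective h').symm
  · have : ¬ G.Adj (e (Sum.inr i)) (e (Sum.inr j)) := fun h =>
      (hAc h).elim (hr i) (hr j)
    simpa [completeSplit, join] using this

lemma isCover_completeSplit (n h : ℕ) :
    IsCover (completeSplit n h) (Finset.univ.map ⟨Sum.inl, Sum.inl_injective⟩) := by
  rintro (i | i) (j | j) hij <;> simp_all [completeSplit, join]

/-- A forest-free graph with spectral radius at least that of `S_{n,h}` is `S_{n,h}`. -/
theorem nonempty_iso_of_adjSpectralRadius_le (hk₁ : 1 ≤ k₁) (hk₂ : 2 ≤ k₂) (hℓ : 2 ≤ ℓ)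
    (hh : h = k₁ + ℓ * k₂ - 1) (hn : 2 ^ (4 * h) ≤ n)
    {V : Type*} [Fintype V] (hV : Fintype.card V = n) {G : SimpleGraph V}
    (hfree : (starPathForest k₁ k₂ ℓ).Free G)
    (hρ : adjSpectralRadius (completeSplit n h) ≤ adjSpectralRadius G) :
    Nonempty (G ≃g completeSplit n h) := by
  obtain ⟨b4, -⟩ := parameter_bounds hk₁ hk₂ hℓ hh
  have hlt : h < n := by
    have h1 := Nat.lt_two_pow_self (n := 4 * h)
    omega
  have b4' : (4 : ℝ) ≤ h := by exact_mod_cast b4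
  have hlt' : (h : ℝ) < n := by exact_mod_cast hlt
  have : Nonempty V := Fintype.card_pos_iff.mp (by omega)
  have : Nonempty (Fin h ⊕ Fin (n - h)) := ⟨Sum.inl ⟨0, by omega⟩⟩
  have h1 := adjSpectralRadius_completeSplit n h (by omega) hlt
  have h0 := adjSpectralRadius_nonneg (completeSplit n h)
  have hpos : 0 < (h : ℝ) * (n - h) := mul_pos (by linarith) (by linarith)
  have h2 : (h : ℝ) - 1 < adjSpectralRadius (completeSplit n h) := by nlinarith
  have h3 : (h : ℝ) * (n - h) ≤ adjSpectralRadius G * (adjSpectralRadius G - (h - 1)) :=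
    h1.trans (mul_le_mul hρ (by linarith) (by linarith) (by linarith))
  obtain ⟨-, A, hA, hAc⟩ := eq_and_exists_isCover hk₁ hk₂ hℓ hh hn n (by omega) le_rfl hV G hfree (by
    rw [Real.mul_self_sqrt (Nat.cast_nonneg n)]; linarith)
  refine nonempty_iso_completeSplit hV hA hAc
    ((hAc.adjSpectralRadius_bound (by linarith) (by omega)).2 ?_)
  rw [hA, hV]
  exact h3

end Main

end StarPathForest

theorem mainTheorem3 (k₁ k₂ ℓ n : ℕ) (hk₁ : 1 ≤ k₁) (hk₂ : 2 ≤ k₂) (hℓ : 2 ≤ ℓ)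
    (hn : max (2 ^ (4 * (k₁ + ℓ * k₂ - 1)))
      (((4 * ℓ ^ 2 - 2 * ℓ + 1) * k₁ + (2 * ℓ ^ 2 + 3 * ℓ - 4) * k₂ + 3) ^ 2) ≤ n)
    (V : Type*) [Fintype V] (hV : Fintype.card V = n) :
    StarPathForest.spectralExtremal V (StarPathForest.starPathForest k₁ k₂ ℓ) =
      {G : SimpleGraph V |
        Nonempty (G ≃g StarPathForest.completeSplit n (k₁ + ℓ * k₂ - 1))} := by
  set h := k₁ + ℓ * k₂ - 1 with hh
  have hn' : 2 ^ (4 * h) ≤ n := le_of_max_le_left hn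
  have hcard : Fintype.card (Fin h ⊕ Fin (n - h)) = Fintype.card V := by
    have h1 := Nat.lt_two_pow_self (n := 4 * h)
    rw [hV, Fintype.card_sum, Fintype.card_fin, Fintype.card_fin]
    omega
  have hsplit : (StarPathForest.starPathForest k₁ k₂ ℓ).Free
      (StarPathForest.completeSplit n h) := by
    refine (StarPathForest.isCover_completeSplit n h).starPathForest_free (by omega) ?_
    rw [Finset.card_map, Finset.card_univ, Fintype.card_fin]
    omega
  have hiso : ∀ {G : SimpleGraph V}, (StarPathForest.starPathForest k₁ k₂ ℓ).Free G →
      StarPathForest.adjSpectralRadius (StarPathForest.completeSplit n h) ≤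
        StarPathForest.adjSpectralRadius G →
      Nonempty (G ≃g StarPathForest.completeSplit n h) := fun hfree hρ =>
    StarPathForest.nonempty_iso_of_adjSpectralRadius_le hk₁ hk₂ hℓ hh hn' hV hfree hρ
  ext G
  constructor
  · rintro ⟨hfree, hmax⟩
    refine hiso hfree ?_
    set e : V ≃ Fin h ⊕ Fin (n - h) := Fintype.equivOfCardEq hcard.symm
    have i := SimpleGraph.Iso.comap e (StarPathForest.completeSplit n h)
    rw [← StarPathForest.adjSpectralRadius_congr i]
    exact hmax _ ((SimpleGraph.free_congr_right i).mpr hsplit)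
  · rintro ⟨i⟩
    refine ⟨(SimpleGraph.free_congr_right i).mpr hsplit, fun G' hfree' => ?_⟩
    rw [StarPathForest.adjSpectralRadius_congr i]
    by_contra! hlt
    obtain ⟨i'⟩ := hiso hfree' hlt.le
    rw [StarPathForest.adjSpectralRadius_congr i'] at hlt
    exact lt_irrefl _ hlt
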